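/- For each $n\ge 1$ let $y=(y_1,\dots,y_n)$ be observed from the normal means model $y=\theta+\epsilon$, $\epsilon\sim N(0,I_n)$, $\theta\in\mathbb R^n$, and let the true parameter $\theta^*=\theta^{*(n)}\in\mathbb R^n$ have exactly $s=s^{(n)}$ nonzero entries, with $s\ge 1$ for all large $n$ and $s=o(n)$. Given a deterministic global scale $\tau=\tau_n>0$, let $\theta$ have the prior density $\pi(\theta)=\prod_{i=1}^n \tau^{-1}\pi_0(\theta_i/\tau)$, where $\pi_0$ is a fixed probability density on $\mathbb R$ that is strictly decreasing on $(0,\infty)$ and increasing on $(-\infty,0)$, and that has a polynomial tail of order $\alpha>1$: there are positive constants $M$ and $A<B$ with $A|t|^{-\alpha}\le\pi_0(t)\le B|t|^{-\alpha}$ for all $|t|>M$. Let $\pi(\cdot\mid y)$ be the posterior distribution and $E^*$ the expectation over $y\sim N(\theta^*,I_n)$. For positive sequences write $a_n\prec b_n$ if $b_n/a_n\to\infty$. Let $\omega>0$ be a constant, and suppose that for some constant $c\in(0,1+\omega/2)$, for all large $n$, $$\tau^{\alpha-1}\ge (1/n)^c\{\log(n/s)\}^{1/2},\qquad\text{and}\qquad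 \tau^{\alpha-1}\prec (s/n)^\alpha\{\log(n/s)\}^{(\alpha+1)/2}.$$ Then $$\lim_{n\to\infty}E^*\bigl(\pi[\|\theta-\theta^*\|_2\ge C_1(\omega)\{s\log n\}^{1/2}\mid y]\bigr)=0,$$ $$\lim_{n\to\infty}E^*\bigl(\pi[\|\theta-\theta^*\|_1\ge s\,C_2(\omega)\{\log n\}^{1/2}\mid y]\bigr)=0,$$ where $C_1(\omega)=\sqrt{2+\omega}+\sqrt{\omega}$ and $C_2(\omega)=\sqrt{2+\omega}+\sqrt{\omega^2/5}+\sqrt{\omega/5}$. -/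

import Mathlib

open MeasureTheory ProbabilityTheory Filter Topology
open scoped ENNReal

namespace NormalMeans

/-- `π₀` is a probability density on `ℝ` (with respect to Lebesgue measure). -/
structure IsProbDensity (π₀ : ℝ → ℝ) : Prop where
  measurable : Measurable π₀
  nonneg : ∀ t, 0 ≤ π₀ t
  lintegral_eq_one : ∫⁻ t, ENNReal.ofReal (π₀ t) = 1

/-- The tail of `π₀` decays polynomially with polynomial order `α`. -/
def HasPolynomialTail (π₀ : ℝ → ℝ) (α : ℝ) : Prop :=
  ∃ M A B : ℝ, 0 < M ∧ 0 < A ∧ A < B ∧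
    ∀ t : ℝ, M < |t| → A * |t| ^ (-α) ≤ π₀ t ∧ π₀ t ≤ B * |t| ^ (-α)

/-- `a ≺ b` for sequences of reals that are eventually positive: `b n / a n → ∞`. -/
def StrictlySmallerOrder (a b : ℕ → ℝ) : Prop :=
  Tendsto (fun n => b n / a n) atTop atTop

/-- The law `N(θ, I_n)` of the data `y = θ + ε`, `ε ∼ N(0, I_n)`. -/
noncomputable def dataLaw {n : ℕ} (θ : Fin n → ℝ) : Measure (Fin n → ℝ) :=
  Measure.pi fun i => gaussianReal (θ i) 1

/-- The likelihood, i.e. the Lebesgue density of `N(θ, I_n)` at the data `y`. -/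
noncomputable def likelihood {n : ℕ} (y θ : Fin n → ℝ) : ℝ :=
  ∏ i, gaussianPDFReal (θ i) 1 (y i)

/-- The prior density `∏ i, (1/τ) π₀ (θ i / τ)` with global scale `τ`. -/
noncomputable def priorDensity {n : ℕ} (π₀ : ℝ → ℝ) (τ : ℝ) (θ : Fin n → ℝ) : ℝ :=
  ∏ i, (1 / τ) * π₀ (θ i / τ)

/-- Likelihood times prior, as a measure in the parameter `θ`. -/
noncomputable def unnormalizedPosterior {n : ℕ} (π₀ : ℝ → ℝ) (τ : ℝ) (y : Fin n → ℝ) :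
    Measure (Fin n → ℝ) :=
  volume.withDensity fun θ => ENNReal.ofReal (likelihood y θ * priorDensity π₀ τ θ)

/-- The posterior distribution of `θ` given the data `y`, by Bayes' formula. -/
noncomputable def posterior {n : ℕ} (π₀ : ℝ → ℝ) (τ : ℝ) (y : Fin n → ℝ) :
    Measure (Fin n → ℝ) :=
  (unnormalizedPosterior π₀ τ y Set.univ)⁻¹ • unnormalizedPosterior π₀ τ y

/-- `E*[π(A | y)]`: the expected posterior probability of `A` for data from `N(θ', I_n)`. -/
noncomputable def expectedPosterior {n : ℕ} (π₀ : ℝ → ℝ) (τ : ℝ) (θ' : Fin n → ℝ)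
    (A : Set (Fin n → ℝ)) : ℝ≥0∞ :=
  ∫⁻ y, posterior π₀ τ y A ∂(dataLaw θ')

/-- The `L₂` (Euclidean) norm of a vector. -/
noncomputable def normL2 {n : ℕ} (v : Fin n → ℝ) : ℝ := ‖WithLp.toLp 2 v‖

/-- The `L₁` norm of a vector. -/
noncomputable def normL1 {n : ℕ} (v : Fin n → ℝ) : ℝ := ∑ i, |v i|

/-- The constant of the `L₂` rate. -/
noncomputable def constL2 (ω : ℝ) : ℝ := √(2 + ω) + √ω

/-- The constant of the `L₁` rate. -/
noncomputable def constL1 (ω : ℝ) : ℝ := √(2 + ω) + √(ω ^ 2 / 5) + √(ω / 5)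

end NormalMeans

namespace NormalMeans

/-! The posterior factorizes over coordinates, so Markov's inequality applied to a sum of coordinate
losses reduces both limits to one-dimensional estimates. With `ℓ = √(log n)`, the loss is `|θ_i -
θ*_i| ^ p`, where `p = 2` after squaring for the Euclidean norm and `p = 1` for the other.

Signal coordinates (`exists_excess_loss_le`): the marginal of `y` is at least of order `τ^(α-1)
(|y|+2)^(-α)`. For `|t| ≥ 1` the prior carries the same factor `τ^(α-1)`, which cancels and leaves a
Gaussian in `y - t` times a polynomial. For `|t| < 1` the factor is missing, but the Gaussian
supplies it once `|y - t| > T` with `exp(-(1-η)T²/2) ≤ τ^(α-1)`. Hence the loss beyond `(√(1+η)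
T)^p` has bounded expectation, uniformly in the true value. The lower bound on `τ` allows `T = ρℓ`
with `ρ² = 2c/(1-η)`, and `c < 1 + ω/2` gives `√(1+η) ρ < √(2+ω)` for small `η`.

Null coordinates (`exists_null_moment_le`): the marginal also dominates a multiple of the standard
normal density, so averaging over `y` turns posterior moments into prior moments. The prior moment
of order `q < α - 1` is a constant times `τ^q`. The upper bound on `τ` gives `(n/s) τ^q → 0` as soon
as `q > (α-1)/α` (`tendsto_ratio_mul_rpow`).

The threshold exceeds the allowed signal loss by `δ s ℓ^p`; dividing the `s` bounded excesses and
the `n` null moments by it gives a bound tending to zero. -/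

/-! ### Factorization of the posterior over coordinates. -/

/-- Tonelli for a product of functions of separate coordinates. -/
theorem lintegral_prod_coordinates {n : ℕ} (f : Fin n → ℝ → ℝ≥0∞) (hf : ∀ i, Measurable (f i)) :
    ∫⁻ x : Fin n → ℝ, ∏ i, f i (x i) = ∏ i, ∫⁻ t, f i t := by
  induction n with
  | zero => simp [volume_pi]
  | succ n ih =>
    have hmp := (volume_preserving_piFinSuccAbove (fun _ : Fin (n + 1) => ℝ) 0).symm
    rw [← hmp.lintegral_comp_emb (MeasurableEquiv.measurableEmbedding _)]
    have hsplit : ∀ z : ℝ × (Fin n → ℝ),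
        ∏ i, f i ((MeasurableEquiv.piFinSuccAbove (fun _ : Fin (n + 1) => ℝ) 0).symm z i)
          = f 0 z.1 * ∏ i, f i.succ (z.2 i) := by
      intro z
      rw [Fin.prod_univ_succ]
      rfl
    simp_rw [hsplit]
    have hm : Measurable fun x : Fin n → ℝ => ∏ i, f (Fin.succ i) (x i) :=
      Finset.measurable_prod _ fun i _ => (hf i.succ).comp (measurable_pi_apply i)
    rw [Measure.volume_eq_prod, lintegral_prod_mul (hf 0).aemeasurable hm.aemeasurable,
      ih _ fun i => hf i.succ, Fin.prod_univ_succ]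

theorem lintegral_coordinate_mul_prod {n : ℕ} (k : Fin n → ℝ → ℝ≥0∞) (hk : ∀ i, Measurable (k i))
    (i : Fin n) (g : ℝ → ℝ≥0∞) (hg : Measurable g) :
    ∫⁻ x : Fin n → ℝ, g (x i) * ∏ j, k j (x j)
      = (∫⁻ t, g t * k i t) * ∏ j ∈ Finset.univ.erase i, ∫⁻ t, k j t := by
  have hint : ∀ x : Fin n → ℝ, g (x i) * ∏ j, k j (x j)
      = ∏ j, (Function.update k i fun t => g t * k i t) j (x j) := by
    intro x
    rw [← Finset.mul_prod_erase Finset.univ (fun j => k j (x j)) (Finset.mem_univ i),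
      ← Finset.mul_prod_erase Finset.univ (fun j => Function.update k i _ j (x j))
        (Finset.mem_univ i), Function.update_self, mul_assoc]
    congr 2
    refine Finset.prod_congr rfl fun j hj => ?_
    rw [Function.update_of_ne (Finset.ne_of_mem_erase hj)]
  simp_rw [hint]
  rw [lintegral_prod_coordinates]
  · rw [← Finset.mul_prod_erase Finset.univ _ (Finset.mem_univ i), Function.update_self]
    congr 1
    refine Finset.prod_congr rfl fun j hj => ?_
    rw [Function.update_of_ne (Finset.ne_of_mem_erase hj)]
  · intro j
    by_cases h : j = i
    · subst h
      rw [Function.update_self]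
      exact hg.mul (hk _)
    · rw [Function.update_of_ne h]
      exact hk j

/-- The prior density of a single coordinate. -/
noncomputable def scaledPrior (π₀ : ℝ → ℝ) (τ t : ℝ) : ℝ := (1 / τ) * π₀ (t / τ)

/-- Likelihood times prior for a single coordinate. -/
noncomputable def jointDensity (π₀ : ℝ → ℝ) (τ y t : ℝ) : ℝ≥0∞ :=
  ENNReal.ofReal (gaussianPDFReal t 1 y * scaledPrior π₀ τ t)

/-- The marginal density of a single observation. -/
noncomputable def marginal (π₀ : ℝ → ℝ) (τ y : ℝ) : ℝ≥0∞ := ∫⁻ t, jointDensity π₀ τ y t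

/-- The posterior expectation of `g` for a single coordinate. -/
noncomputable def postMean (π₀ : ℝ → ℝ) (τ : ℝ) (g : ℝ → ℝ≥0∞) (y : ℝ) : ℝ≥0∞ :=
  (marginal π₀ τ y)⁻¹ * ∫⁻ t, g t * jointDensity π₀ τ y t

variable {π₀ : ℝ → ℝ} {α M A B τ : ℝ}

theorem scaledPrior_nonneg (hd : IsProbDensity π₀) (hτ : 0 < τ) (t : ℝ) :
    0 ≤ scaledPrior π₀ τ t :=
  mul_nonneg (by positivity) (hd.nonneg _)

theorem measurable_scaledPrior (hd : IsProbDensity π₀) : Measurable (scaledPrior π₀ τ) :=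
  (hd.measurable.comp (measurable_id.div_const τ)).const_mul _

theorem measurable_gaussianPDFReal_uncurry :
    Measurable fun z : ℝ × ℝ => gaussianPDFReal z.2 1 z.1 := by
  unfold gaussianPDFReal
  fun_prop

theorem measurable_jointDensity_uncurry (hd : IsProbDensity π₀) :
    Measurable fun z : ℝ × ℝ => jointDensity π₀ τ z.1 z.2 :=
  (measurable_gaussianPDFReal_uncurry.mul
    ((measurable_scaledPrior hd).comp measurable_snd)).ennreal_ofReal

theorem measurable_jointDensity (hd : IsProbDensity π₀) (y : ℝ) :
    Measurable (jointDensity π₀ τ y) := by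
  have h := (measurable_scaledPrior (τ := τ) hd)
  unfold jointDensity gaussianPDFReal
  fun_prop

theorem measurable_marginal (hd : IsProbDensity π₀) : Measurable (marginal π₀ τ) :=
  (measurable_jointDensity_uncurry hd).lintegral_prod_right'

theorem measurable_postMean (hd : IsProbDensity π₀) {g : ℝ → ℝ≥0∞} (hg : Measurable g) :
    Measurable (postMean π₀ τ g) :=
  (measurable_marginal hd).inv.mul
    (Measurable.lintegral_prod_right'
      ((hg.comp measurable_snd).mul (measurable_jointDensity_uncurry hd)))

theorem ofReal_likelihood_mul_prior (hd : IsProbDensity π₀) (hτ : 0 < τ) {n : ℕ}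
    (y t : Fin n → ℝ) :
    ENNReal.ofReal (likelihood y t * priorDensity π₀ τ t) = ∏ i, jointDensity π₀ τ (y i) (t i) := by
  unfold likelihood priorDensity jointDensity
  rw [← Finset.prod_mul_distrib, ENNReal.ofReal_prod_of_nonneg]
  · rfl
  · exact fun i _ => mul_nonneg (gaussianPDFReal_nonneg _ _ _) (scaledPrior_nonneg hd hτ (t i))

/-- The marginals of the other coordinates appear in both numerator and normalizer. Cancelling them
in `ℝ≥0∞` is what requires marginals that are neither zero nor infinite. -/
theorem lintegral_posterior_coordinate (hd : IsProbDensity π₀) (hτ : 0 < τ)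
    (hpos : ∀ y, marginal π₀ τ y ≠ 0) (hfin : ∀ y, marginal π₀ τ y ≠ ∞) {n : ℕ}
    (y : Fin n → ℝ) (i : Fin n) {g : ℝ → ℝ≥0∞} (hg : Measurable g) :
    ∫⁻ t, g (t i) ∂(posterior π₀ τ y) = postMean π₀ τ g (y i) := by
  have hk : ∀ j, Measurable (jointDensity π₀ τ (y j)) := fun j => measurable_jointDensity hd _
  have hprod : Measurable fun t : Fin n → ℝ => ∏ j, jointDensity π₀ τ (y j) (t j) :=
    Finset.measurable_prod _ fun j _ => (hk j).comp (measurable_pi_apply j)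
  have hdens : (fun t : Fin n → ℝ => ENNReal.ofReal (likelihood y t * priorDensity π₀ τ t))
      = fun t => ∏ j, jointDensity π₀ τ (y j) (t j) :=
    funext fun t => ofReal_likelihood_mul_prior hd hτ y t
  unfold posterior unnormalizedPosterior postMean
  rw [hdens, lintegral_smul_measure, withDensity_apply _ MeasurableSet.univ, setLIntegral_univ,
    lintegral_prod_coordinates _ hk,
    lintegral_withDensity_eq_lintegral_mul _ hprod
      (show Measurable fun t : Fin n → ℝ => g (t i) from hg.comp (measurable_pi_apply i))]
  simp only [Pi.mul_apply]
  simp_rw [mul_comm (∏ j, jointDensity π₀ τ (y j) _)]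
  rw [lintegral_coordinate_mul_prod _ hk i g hg,
    ← Finset.mul_prod_erase Finset.univ _ (Finset.mem_univ i)]
  change (marginal π₀ τ (y i) * ∏ j ∈ Finset.univ.erase i, marginal π₀ τ (y j))⁻¹ •
    (_ * ∏ j ∈ Finset.univ.erase i, marginal π₀ τ (y j)) = _
  have h0 : ∏ j ∈ Finset.univ.erase i, marginal π₀ τ (y j) ≠ 0 :=
    Finset.prod_ne_zero_iff.2 fun j _ => hpos _
  have h1 : ∏ j ∈ Finset.univ.erase i, marginal π₀ τ (y j) ≠ ∞ :=
    ENNReal.prod_ne_top fun j _ => hfin _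
  rw [smul_eq_mul, ENNReal.mul_inv (Or.inr h1) (Or.inr h0), mul_mul_mul_comm,
    ENNReal.inv_mul_cancel h0 h1, mul_one]

/-- Markov's inequality for the expected posterior probability of a sum of coordinate losses. -/
theorem expectedPosterior_le (hd : IsProbDensity π₀) (hτ : 0 < τ)
    (hpos : ∀ y, marginal π₀ τ y ≠ 0) (hfin : ∀ y, marginal π₀ τ y ≠ ∞) {n : ℕ}
    (θ' : Fin n → ℝ) (g : Fin n → ℝ → ℝ≥0∞) (hg : ∀ i, Measurable (g i)) {K : ℝ≥0∞}
    (hK0 : K ≠ 0) (hK : K ≠ ∞) {S : Set (Fin n → ℝ)} (hS : S ⊆ {t | K ≤ ∑ i, g i (t i)}) :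
    expectedPosterior π₀ τ θ' S
      ≤ K⁻¹ * ∑ i, ∫⁻ y, postMean π₀ τ (g i) y ∂(gaussianReal (θ' i) 1) := by
  have hgi : ∀ i, Measurable fun t : Fin n → ℝ => g i (t i) :=
    fun i => (hg i).comp (measurable_pi_apply i)
  have hpt : ∀ y, posterior π₀ τ y S ≤ K⁻¹ * ∑ i, postMean π₀ τ (g i) (y i) := by
    intro y
    have hmarkov := mul_meas_ge_le_lintegral (μ := posterior π₀ τ y)
      (Finset.measurable_sum Finset.univ fun i _ => hgi i) K
    rw [lintegral_finsetSum _ fun i _ => hgi i] at hmarkov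
    simp_rw [lintegral_posterior_coordinate hd hτ hpos hfin y _ (hg _)] at hmarkov
    rw [mul_comm, ← div_eq_mul_inv, ENNReal.le_div_iff_mul_le (Or.inl hK0) (Or.inl hK), mul_comm]
    -- Markov is applied to the measurable superset, so `S` itself need not be measurable.
    exact (mul_le_mul_right (measure_mono hS) K).trans hmarkov
  have hm : ∀ i, Measurable fun y : Fin n → ℝ => postMean π₀ τ (g i) (y i) :=
    fun i => (measurable_postMean hd (hg i)).comp (measurable_pi_apply i)
  calc expectedPosterior π₀ τ θ' S
      ≤ ∫⁻ y, K⁻¹ * ∑ i, postMean π₀ τ (g i) (y i) ∂(dataLaw θ') := lintegral_mono hpt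
    _ = K⁻¹ * ∑ i, ∫⁻ y, postMean π₀ τ (g i) (y i) ∂(dataLaw θ') := by
        rw [lintegral_const_mul _ (Finset.measurable_sum _ fun i _ => hm i),
          lintegral_finsetSum _ fun i _ => hm i]
    _ = _ := by
        congr 1
        refine Finset.sum_congr rfl fun i _ => ?_
        exact (measurePreserving_eval (fun j => gaussianReal (θ' j) 1) i).lintegral_comp
          (measurable_postMean hd (hg i))

/-! ### Gaussian estimates. -/

/-- The standard normal density. -/
noncomputable def gauss (x : ℝ) : ℝ := gaussianPDFReal 0 1 x

theorem gauss_eq (x : ℝ) : gauss x = (√(2 * Real.pi))⁻¹ * Real.exp (-(x ^ 2) / 2) := by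
  simp [gauss, gaussianPDFReal]

theorem gaussianPDFReal_eq_gauss (t y : ℝ) : gaussianPDFReal t 1 y = gauss (y - t) := by
  simp [gauss, gaussianPDFReal]

theorem gauss_pos (x : ℝ) : 0 < gauss x := gaussianPDFReal_pos _ _ _ one_ne_zero

theorem gauss_nonneg (x : ℝ) : 0 ≤ gauss x := (gauss_pos x).le

theorem gauss_anti {x y : ℝ} (h : |x| ≤ |y|) : gauss y ≤ gauss x := by
  rw [gauss_eq, gauss_eq]
  have := sq_le_sq.2 h
  gcongr

theorem gauss_le_exp (x : ℝ) : gauss x ≤ Real.exp (-(x ^ 2) / 2) := by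
  rw [gauss_eq]
  refine mul_le_of_le_one_left (Real.exp_nonneg _) (inv_le_one_of_one_le₀ ?_)
  rw [Real.one_le_sqrt]
  nlinarith [Real.pi_gt_three]

theorem gauss_le_one (x : ℝ) : gauss x ≤ 1 :=
  (gauss_le_exp x).trans (Real.exp_le_one_iff.2 (by nlinarith [sq_nonneg x]))

theorem measurable_gauss : Measurable gauss := measurable_gaussianPDFReal 0 1

theorem lintegral_gauss_sub (t : ℝ) : ∫⁻ y, ENNReal.ofReal (gauss (y - t)) = 1 := by
  simp_rw [← gaussianPDFReal_eq_gauss]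
  exact lintegral_gaussianPDFReal_eq_one t one_ne_zero

theorem jointDensity_eq (π₀ : ℝ → ℝ) (τ y t : ℝ) :
    jointDensity π₀ τ y t = ENNReal.ofReal (gauss (y - t) * scaledPrior π₀ τ t) := by
  rw [jointDensity, gaussianPDFReal_eq_gauss]

theorem lintegral_gaussianReal_eq (μ : ℝ) {f : ℝ → ℝ≥0∞} (hf : Measurable f) :
    ∫⁻ y, f y ∂(gaussianReal μ 1) = ∫⁻ y, ENNReal.ofReal (gauss (y - μ)) * f y := by
  rw [gaussianReal_of_var_ne_zero μ one_ne_zero,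
    lintegral_withDensity_eq_lintegral_mul _ (measurable_gaussianPDF μ 1) hf]
  simp [gaussianPDF, gaussianPDFReal_eq_gauss]

/-- Polynomials are dominated by Gaussian growth. -/
theorem exists_rpow_le_exp_sq (β : ℝ) {η : ℝ} (hη : 0 < η) :
    ∃ C : ℝ, 0 < C ∧ ∀ x : ℝ, 0 ≤ x → (3 + x) ^ β ≤ C * Real.exp (η * x ^ 2) := by
  obtain ⟨k, hk⟩ := exists_nat_ge β
  -- `z^k ≤ k! e^z` at `z = 3 + x`, then `x ≤ η x² + 1/(4η)` by completing the square.
  refine ⟨k.factorial * Real.exp (3 + 1 / (4 * η)), by positivity, fun x hx => ?_⟩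
  have h1 : (3 + x) ^ β ≤ (3 + x) ^ (k : ℝ) := Real.rpow_le_rpow_of_exponent_le (by linarith) hk
  have h2 := Real.pow_div_factorial_le_exp (3 + x) (by linarith) k
  rw [div_le_iff₀ (by positivity)] at h2
  have h3 : 3 + x ≤ (3 + 1 / (4 * η)) + η * x ^ 2 := by
    have : 0 ≤ η * (x - 1 / (2 * η)) ^ 2 := by positivity
    have e : η * (x - 1 / (2 * η)) ^ 2 = η * x ^ 2 - x + 1 / (4 * η) := by field_simp; ring
    linarith
  rw [Real.rpow_natCast] at h1
  calc (3 + x) ^ β ≤ Real.exp (3 + x) * k.factorial := h1.trans h2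
    _ ≤ Real.exp ((3 + 1 / (4 * η)) + η * x ^ 2) * k.factorial := by gcongr
    _ = _ := by rw [Real.exp_add]; ring

theorem lintegral_exp_neg_mul_sq_lt_top {b : ℝ} (hb : 0 < b) :
    ∫⁻ x : ℝ, ENNReal.ofReal (Real.exp (-b * x ^ 2)) < ∞ :=
  (integrable_exp_neg_mul_sq hb).lintegral_lt_top

/-! ### Tails of the scaled prior and lower bounds for the marginal. -/

/-- A density bounded above and below by multiples of `|t| ^ (-α)` for `|t| > M`. -/
structure TailBounds (π₀ : ℝ → ℝ) (α M A B : ℝ) : Prop where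
  M_pos : 0 < M
  A_pos : 0 < A
  A_lt_B : A < B
  lower : ∀ t : ℝ, M < |t| → A * |t| ^ (-α) ≤ π₀ t
  upper : ∀ t : ℝ, M < |t| → π₀ t ≤ B * |t| ^ (-α)

theorem TailBounds.B_pos (hb : TailBounds π₀ α M A B) : 0 < B := hb.A_pos.trans hb.A_lt_B

theorem inv_mul_div_rpow_neg (hτ : 0 < τ) (α : ℝ) {x : ℝ} (hx : 0 ≤ x) :
    (1 / τ) * (x / τ) ^ (-α) = τ ^ (α - 1) * x ^ (-α) := by
  rw [Real.div_rpow hx hτ.le, Real.rpow_sub_one hτ.ne', Real.rpow_neg hτ.le]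
  have := (Real.rpow_pos_of_pos hτ α).ne'
  field_simp

theorem lt_abs_div (hτ : 0 < τ) {t : ℝ} (ht : M * τ < |t|) : M < |t / τ| := by
  rw [abs_div, abs_of_pos hτ, lt_div_iff₀ hτ]
  exact ht

theorem TailBounds.scaledPrior_ge (hb : TailBounds π₀ α M A B) (hτ : 0 < τ) {t : ℝ}
    (ht : M * τ < |t|) : A * (τ ^ (α - 1) * |t| ^ (-α)) ≤ scaledPrior π₀ τ t := by
  have h := hb.lower (t / τ) (lt_abs_div hτ ht)
  rw [abs_div, abs_of_pos hτ] at h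
  rw [← inv_mul_div_rpow_neg hτ α (abs_nonneg t), scaledPrior]
  calc A * (1 / τ * (|t| / τ) ^ (-α)) = 1 / τ * (A * (|t| / τ) ^ (-α)) := by ring
    _ ≤ _ := by gcongr

theorem TailBounds.scaledPrior_le (hb : TailBounds π₀ α M A B) (hτ : 0 < τ) {t : ℝ}
    (ht : M * τ < |t|) : scaledPrior π₀ τ t ≤ B * (τ ^ (α - 1) * |t| ^ (-α)) := by
  have h := hb.upper (t / τ) (lt_abs_div hτ ht)
  rw [abs_div, abs_of_pos hτ] at h
  rw [← inv_mul_div_rpow_neg hτ α (abs_nonneg t), scaledPrior]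
  calc 1 / τ * π₀ (t / τ) ≤ 1 / τ * (B * (|t| / τ) ^ (-α)) := by gcongr
    _ = _ := by ring

theorem lintegral_mul_scaledPrior (hd : IsProbDensity π₀) (hτ : 0 < τ) {f : ℝ → ℝ≥0∞}
    (hf : Measurable f) :
    ∫⁻ t, f t * ENNReal.ofReal (scaledPrior π₀ τ t)
      = ∫⁻ u, f (τ * u) * ENNReal.ofReal (π₀ u) := by
  have hm : Measurable fun u => f (τ * u) * ENNReal.ofReal (π₀ u) :=
    (hf.comp (measurable_const_mul τ)).mul hd.measurable.ennreal_ofReal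
  have hmap := Real.map_volume_mul_left (inv_ne_zero hτ.ne')
  have key : ∫⁻ t, f (τ * (τ⁻¹ * t)) * ENNReal.ofReal (π₀ (τ⁻¹ * t))
      = ENNReal.ofReal τ * ∫⁻ u, f (τ * u) * ENNReal.ofReal (π₀ u) := by
    rw [← lintegral_map (f := fun u => f (τ * u) * ENNReal.ofReal (π₀ u)) hm
      (measurable_const_mul τ⁻¹), hmap, lintegral_smul_measure, inv_inv, abs_of_pos hτ, smul_eq_mul]
  have hτ' : ENNReal.ofReal (1 / τ) * ENNReal.ofReal τ = 1 := by
    rw [← ENNReal.ofReal_mul (by positivity), one_div, inv_mul_cancel₀ hτ.ne', ENNReal.ofReal_one]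
  rw [← one_mul (∫⁻ u, f (τ * u) * ENNReal.ofReal (π₀ u)), ← hτ', mul_assoc, ← key,
    ← lintegral_const_mul' _ _ ENNReal.ofReal_ne_top]
  refine lintegral_congr fun t => ?_
  rw [scaledPrior, ENNReal.ofReal_mul (by positivity), mul_inv_cancel_left₀ hτ.ne',
    mul_left_comm, div_eq_inv_mul t τ]

theorem lintegral_scaledPrior (hd : IsProbDensity π₀) (hτ : 0 < τ) :
    ∫⁻ t, ENNReal.ofReal (scaledPrior π₀ τ t) = 1 := by
  have h := lintegral_mul_scaledPrior hd hτ (f := fun _ => 1) measurable_const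
  simpa [hd.lintegral_eq_one] using h

theorem marginal_ne_top (hd : IsProbDensity π₀) (hτ : 0 < τ) (y : ℝ) : marginal π₀ τ y ≠ ∞ := by
  refine ne_top_of_le_ne_top ENNReal.one_ne_top ?_
  rw [← lintegral_scaledPrior hd hτ]
  refine lintegral_mono fun t => ?_
  rw [jointDensity_eq]
  exact ENNReal.ofReal_le_ofReal
    (mul_le_of_le_one_left (scaledPrior_nonneg hd hτ t) (gauss_le_one _))

theorem ofReal_mul_le_marginal {a b c y : ℝ} (hab : a ≤ b)
    (h : ∀ t ∈ Set.Icc a b, c ≤ gauss (y - t) * scaledPrior π₀ τ t) :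
    ENNReal.ofReal (c * (b - a)) ≤ marginal π₀ τ y := by
  calc ENNReal.ofReal (c * (b - a)) = ∫⁻ _ in Set.Icc a b, ENNReal.ofReal c := by
        rw [setLIntegral_const, Real.volume_Icc, ENNReal.ofReal_mul' (sub_nonneg.2 hab)]
    _ ≤ ∫⁻ t in Set.Icc a b, jointDensity π₀ τ y t := by
        refine setLIntegral_mono' measurableSet_Icc fun t ht => ?_
        rw [jointDensity_eq]
        exact ENNReal.ofReal_le_ofReal (h t ht)
    _ ≤ marginal π₀ τ y := setLIntegral_le_lintegral _ _

/-- A polynomially decaying lower bound of the marginal density. -/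
noncomputable def polyLower (α A τ y : ℝ) : ℝ := gauss 2 * (A * (τ ^ (α - 1) * (|y| + 2) ^ (-α)))

theorem polyLower_pos (hA : 0 < A) (hτ : 0 < τ) (y : ℝ) : 0 < polyLower α A τ y := by
  have := gauss_pos 2
  unfold polyLower
  positivity

/-- Integrate only over the unit interval at distance 1 to 2 from `y`, on the side away from the
origin. There `|t| ≥ 1 > M * τ`, so the tail bound applies. -/
theorem TailBounds.polyLower_le_marginal (hb : TailBounds π₀ α M A B) (hα : 0 ≤ α)
    (hτ : 0 < τ) (hMτ : M * τ < 1) (y : ℝ) :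
    ENNReal.ofReal (polyLower α A τ y) ≤ marginal π₀ τ y := by
  have key : ∀ t, |y - t| ≤ 2 → 1 ≤ |t| → |t| ≤ |y| + 2 →
      polyLower α A τ y ≤ gauss (y - t) * scaledPrior π₀ τ t := by
    intro t h1 h2 h3
    have hA := hb.A_pos
    have hg : gauss 2 ≤ gauss (y - t) := gauss_anti (by rwa [abs_of_pos (two_pos : (0:ℝ) < 2)])
    have hp := hb.scaledPrior_ge hτ (hMτ.trans_le h2)
    have hr : (|y| + 2) ^ (-α) ≤ |t| ^ (-α) :=
      Real.rpow_le_rpow_of_nonpos (by linarith) h3 (by linarith)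
    unfold polyLower
    refine mul_le_mul hg (le_trans ?_ hp) (by positivity) (gauss_nonneg _)
    gcongr
  rcases le_total 0 y with hy | hy
  · have := ofReal_mul_le_marginal (π₀ := π₀) (τ := τ) (a := y + 1) (b := y + 2)
      (c := polyLower α A τ y) (y := y) (by linarith) fun t ht => by
        have h0 : 0 ≤ t := by linarith [ht.1]
        refine key t ?_ ?_ ?_
        · rw [abs_le]; constructor <;> linarith [ht.1, ht.2]
        · rw [abs_of_nonneg h0]; linarith [ht.1]
        · rw [abs_of_nonneg h0, abs_of_nonneg hy]; linarith [ht.2]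
    convert this using 2
    ring
  · have := ofReal_mul_le_marginal (π₀ := π₀) (τ := τ) (a := y - 2) (b := y - 1)
      (c := polyLower α A τ y) (y := y) (by linarith) fun t ht => by
        have h0 : t ≤ 0 := by linarith [ht.2]
        refine key t ?_ ?_ ?_
        · rw [abs_le]; constructor <;> linarith [ht.1, ht.2]
        · rw [abs_of_nonpos h0]; linarith [ht.2]
        · rw [abs_of_nonpos h0, abs_of_nonpos hy]; linarith [ht.1]
    convert this using 2
    ring

theorem TailBounds.marginal_ne_zero (hb : TailBounds π₀ α M A B) (hα : 0 ≤ α)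
    (hτ : 0 < τ) (hMτ : M * τ < 1) (y : ℝ) : marginal π₀ τ y ≠ 0 :=
  ((ENNReal.ofReal_pos.2 (polyLower_pos hb.A_pos hτ y)).trans_le
    (hb.polyLower_le_marginal hα hτ hMτ y)).ne'

/-- The marginal density dominates the standard normal density up to a constant. -/
theorem TailBounds.gauss_le_marginal (hb : TailBounds π₀ α M A B) (hα : 0 ≤ α)
    (hτ : 0 < τ) (hMτ : (M + 2) * τ ≤ 1) (y : ℝ) :
    ENNReal.ofReal (Real.exp (-1 / 2) * (A * (M + 2) ^ (-α)) * gauss y) ≤ marginal π₀ τ y := by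
  have hA := hb.A_pos
  have hM := hb.M_pos
  -- The window has length `τ`, which cancels the factor `1 / τ` of the prior. Taking it on the same
  -- side as `y` gives `(y - t)² ≤ y² + 1`.
  have key : ∀ t, 0 ≤ y * t → (M + 1) * τ ≤ |t| → |t| ≤ (M + 2) * τ →
      Real.exp (-1 / 2) * (A * (M + 2) ^ (-α)) * gauss y / τ
        ≤ gauss (y - t) * scaledPrior π₀ τ t := by
    intro t h1 h2 h3
    have hg : Real.exp (-1 / 2) * gauss y ≤ gauss (y - t) := by
      have ht2 : t ^ 2 ≤ 1 := by
        rw [← sq_abs]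
        have := abs_nonneg t
        nlinarith
      rw [gauss_eq, gauss_eq, mul_left_comm, ← Real.exp_add]
      gcongr
      nlinarith
    have hp : A * (M + 2) ^ (-α) / τ ≤ scaledPrior π₀ τ t := by
      have h4 := hb.lower (t / τ) (lt_abs_div hτ (by nlinarith))
      have h5 : (M + 2) ^ (-α) ≤ |t / τ| ^ (-α) := by
        refine Real.rpow_le_rpow_of_nonpos (abs_pos.2 ?_) ?_ (by linarith)
        · have : t ≠ 0 := by rintro rfl; rw [abs_zero] at h2; nlinarith
          positivity
        · rw [abs_div, abs_of_pos hτ, div_le_iff₀ hτ]; exact h3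
      rw [scaledPrior, div_eq_mul_one_div, mul_comm]
      have := mul_le_mul_of_nonneg_left h5 hA.le
      gcongr
      linarith
    calc Real.exp (-1 / 2) * (A * (M + 2) ^ (-α)) * gauss y / τ
        = (Real.exp (-1 / 2) * gauss y) * (A * (M + 2) ^ (-α) / τ) := by ring
      _ ≤ _ := mul_le_mul hg hp (by positivity) (gauss_nonneg _)
  have hle : (M + 1) * τ ≤ (M + 2) * τ := by nlinarith
  have hpos : 0 ≤ (M + 1) * τ := by positivity
  have hlen : Real.exp (-1 / 2) * (A * (M + 2) ^ (-α)) * gauss y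
      = Real.exp (-1 / 2) * (A * (M + 2) ^ (-α)) * gauss y / τ * τ :=
    (div_mul_cancel₀ _ hτ.ne').symm
  rcases le_total 0 y with hy | hy
  · have := ofReal_mul_le_marginal (π₀ := π₀) (τ := τ) (y := y) hle fun t ht => by
      have h0 : 0 ≤ t := hpos.trans ht.1
      refine key t (mul_nonneg hy h0) ?_ ?_
      · rw [abs_of_nonneg h0]; exact ht.1
      · rw [abs_of_nonneg h0]; exact ht.2
    rw [hlen]
    convert this using 3
    ring
  · have := ofReal_mul_le_marginal (π₀ := π₀) (τ := τ) (y := y) (neg_le_neg hle) fun t ht => by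
      have h0 : t ≤ 0 := by linarith [ht.2]
      refine key t (mul_nonneg_of_nonpos_of_nonpos hy h0) ?_ ?_
      · rw [abs_of_nonpos h0]; linarith [ht.2]
      · rw [abs_of_nonpos h0]; linarith [ht.1]
    rw [hlen]
    convert this using 3
    ring

/-- Away from the origin the joint density is controlled by the lower bound of the marginal. -/
theorem TailBounds.gauss_mul_scaledPrior_le (hb : TailBounds π₀ α M A B) (hα : 0 ≤ α)
    (hτ : 0 < τ) (hMτ : M * τ < 1) (y : ℝ) {t : ℝ} (ht : 1 ≤ |t|) :
    gauss (y - t) * scaledPrior π₀ τ t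
      ≤ polyLower α A τ y * (B / (gauss 2 * A) * ((3 + |y - t|) ^ α * gauss (y - t))) := by
  have hA := hb.A_pos
  have hB := hb.B_pos
  have hg2 := gauss_pos 2
  have hp := hb.scaledPrior_le hτ (hMτ.trans_le ht)
  have hy : |y| + 2 ≤ |t| * (3 + |y - t|) := by
    have h1 : |y| ≤ |t| + |y - t| := by
      have := abs_add_le t (y - t)
      rwa [add_sub_cancel] at this
    nlinarith [abs_nonneg (y - t)]
  have hr : |t| ^ (-α) ≤ (|y| + 2) ^ (-α) * (3 + |y - t|) ^ α := by
    have h1 : (|y| + 2) ^ α ≤ |t| ^ α * (3 + |y - t|) ^ α := by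
      rw [← Real.mul_rpow (by positivity) (by positivity)]
      exact Real.rpow_le_rpow (by positivity) hy hα
    have h2 : 0 < |t| ^ α := Real.rpow_pos_of_pos (by linarith) _
    have h3 : 0 < (|y| + 2) ^ α := by positivity
    rw [Real.rpow_neg (by positivity), Real.rpow_neg (by positivity), inv_mul_eq_div,
      le_div_iff₀ h3, inv_mul_eq_div, div_le_iff₀ h2]
    linarith
  calc gauss (y - t) * scaledPrior π₀ τ t
      ≤ gauss (y - t) * (B * (τ ^ (α - 1) * ((|y| + 2) ^ (-α) * (3 + |y - t|) ^ α))) := by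
        refine mul_le_mul_of_nonneg_left (hp.trans ?_) (gauss_nonneg _)
        gcongr
    _ = _ := by
        unfold polyLower
        field_simp

theorem inv_marginal_mul_le {y a b : ℝ} {I : ℝ≥0∞} (ha : 0 < a)
    (h : ENNReal.ofReal a ≤ marginal π₀ τ y) (hI : I ≤ ENNReal.ofReal (a * b)) :
    (marginal π₀ τ y)⁻¹ * I ≤ ENNReal.ofReal b := by
  calc (marginal π₀ τ y)⁻¹ * I ≤ (ENNReal.ofReal a)⁻¹ * ENNReal.ofReal (a * b) := by
        gcongr
    _ = ENNReal.ofReal b := by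
        rw [ENNReal.ofReal_mul ha.le, ENNReal.inv_mul_cancel_left
          (ENNReal.ofReal_pos.2 ha).ne' ENNReal.ofReal_ne_top]

/-! ### Posterior concentration around the observation. -/

/-- The posterior second moment of `θ - y` beyond a logarithmic radius is bounded,
uniformly in the observation. -/
theorem TailBounds.exists_postMean_excess_le (hb : TailBounds π₀ α M A B) (hd : IsProbDensity π₀)
    (hα : 0 ≤ α) {η : ℝ} (hη : 0 < η) (hη1 : η < 1) :
    ∃ C : ℝ, 0 ≤ C ∧ ∀ τ T : ℝ, 0 < τ → M * τ < 1 → 0 ≤ T →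
      Real.exp (-((1 - η) / 2) * T ^ 2) ≤ τ ^ (α - 1) → ∀ y,
      postMean π₀ τ (fun t => ENNReal.ofReal (if T < |y - t| then (y - t) ^ 2 else 0)) y
        ≤ ENNReal.ofReal C := by
  have hA := hb.A_pos
  have hB := hb.B_pos
  have hg2 := gauss_pos 2
  obtain ⟨P, hP, hPle⟩ := exists_rpow_le_exp_sq (α + 2) (half_pos hη)
  set b := (1 - η) / 2 with hbdef
  have hb0 : 0 < b := by rw [hbdef]; linarith
  set D := B / (gauss 2 * A) with hD
  set K := P / (gauss 2 * A) with hK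
  have hD0 : 0 < D := by positivity
  have hK0 : 0 < K := by positivity
  set G := ∫⁻ x : ℝ, ENNReal.ofReal (Real.exp (-b * x ^ 2)) with hG
  have hGfin : G ≠ ∞ := (lintegral_exp_neg_mul_sq_lt_top hb0).ne
  -- The part `η / 2` of the Gaussian exponent absorbs all polynomial factors, leaving `b = (1 - η)
  -- / 2`.
  have hv : ∀ x : ℝ, (3 + |x|) ^ α * (x ^ 2 * gauss x) ≤ P * Real.exp (-b * x ^ 2) := by
    intro x
    have h1 : (3 + |x|) ^ α * x ^ 2 ≤ P * Real.exp (η / 2 * x ^ 2) := by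
      refine le_trans ?_ ((hPle |x| (abs_nonneg x)).trans (by rw [sq_abs]))
      rw [Real.rpow_add (by positivity), Real.rpow_two, ← sq_abs x]
      gcongr
      linarith
    calc (3 + |x|) ^ α * (x ^ 2 * gauss x) = ((3 + |x|) ^ α * x ^ 2) * gauss x := by ring
      _ ≤ (P * Real.exp (η / 2 * x ^ 2)) * Real.exp (-(x ^ 2) / 2) :=
        mul_le_mul h1 (gauss_le_exp x) (gauss_nonneg x) (by positivity)
      _ = _ := by rw [mul_assoc, ← Real.exp_add]; congr 2; rw [hbdef]; ring
  -- The first term comes from `|t| ≥ 1`, the second from `|t| < 1`, where the prior mass is at most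
  -- one.
  refine ⟨D * P * G.toReal + K, by positivity, fun τ T hτ hMτ hT hexp y => ?_⟩
  have hl := polyLower_pos (α := α) hA hτ y
  refine inv_marginal_mul_le hl (hb.polyLower_le_marginal hα hτ hMτ y) ?_
  have hpt : ∀ t, ENNReal.ofReal (if T < |y - t| then (y - t) ^ 2 else 0) * jointDensity π₀ τ y t
      ≤ ENNReal.ofReal (polyLower α A τ y) * (ENNReal.ofReal (D * P)
          * ENNReal.ofReal (Real.exp (-b * (y - t) ^ 2))
        + ENNReal.ofReal K * ENNReal.ofReal (scaledPrior π₀ τ t)) := by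
    intro t
    have hs := scaledPrior_nonneg hd hτ t
    rw [jointDensity_eq, ← ENNReal.ofReal_mul (by split_ifs <;> positivity),
      ← ENNReal.ofReal_mul (by positivity), ← ENNReal.ofReal_mul hK0.le,
      ← ENNReal.ofReal_add (by positivity) (by positivity), ← ENNReal.ofReal_mul hl.le]
    refine ENNReal.ofReal_le_ofReal ?_
    split_ifs with hTv
    swap
    · rw [zero_mul]; positivity
    rcases le_or_gt 1 |t| with ht | ht
    · calc (y - t) ^ 2 * (gauss (y - t) * scaledPrior π₀ τ t)
          ≤ (y - t) ^ 2 * (polyLower α A τ y * (D * ((3 + |y - t|) ^ α * gauss (y - t)))) :=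
            mul_le_mul_of_nonneg_left (hb.gauss_mul_scaledPrior_le hα hτ hMτ y ht) (sq_nonneg _)
        _ = polyLower α A τ y * (D * ((3 + |y - t|) ^ α * ((y - t) ^ 2 * gauss (y - t)))) := by ring
        _ ≤ polyLower α A τ y * (D * (P * Real.exp (-b * (y - t) ^ 2))) := by
            exact mul_le_mul_of_nonneg_left (mul_le_mul_of_nonneg_left (hv _) hD0.le) hl.le
        _ ≤ _ := by
            gcongr
            rw [← mul_assoc]
            exact le_add_of_nonneg_right (by positivity)
    -- Here the prior has no factor `τ ^ (α - 1)` to match `polyLower`; the Gaussian beyond radius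
    -- `T` provides it.
    · have hy : |y| + 2 ≤ 3 + |y - t| := by
        have := abs_add_le t (y - t)
        rw [add_sub_cancel] at this
        linarith
      have h1 : 1 ≤ (|y| + 2) ^ (-α) * (3 + |y - t|) ^ α := by
        rw [Real.rpow_neg (by positivity), inv_mul_eq_div, one_le_div (by positivity)]
        exact Real.rpow_le_rpow (by positivity) hy hα
      have hg := gauss_nonneg (y - t)
      have h2 : (y - t) ^ 2 * gauss (y - t) ≤ (|y| + 2) ^ (-α) * (P * τ ^ (α - 1)) := by
        calc (y - t) ^ 2 * gauss (y - t)
            ≤ ((|y| + 2) ^ (-α) * (3 + |y - t|) ^ α) * ((y - t) ^ 2 * gauss (y - t)) :=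
              le_mul_of_one_le_left (by positivity) h1
          _ = (|y| + 2) ^ (-α) * ((3 + |y - t|) ^ α * ((y - t) ^ 2 * gauss (y - t))) := by ring
          _ ≤ (|y| + 2) ^ (-α) * (P * Real.exp (-b * (y - t) ^ 2)) :=
              mul_le_mul_of_nonneg_left (hv _) (by positivity)
          _ ≤ (|y| + 2) ^ (-α) * (P * τ ^ (α - 1)) := by
              gcongr
              refine le_trans (Real.exp_le_exp.2 ?_) hexp
              have : T ^ 2 ≤ (y - t) ^ 2 := by
                rw [← sq_abs (y - t)]
                gcongr
              nlinarith
      calc (y - t) ^ 2 * (gauss (y - t) * scaledPrior π₀ τ t)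
          = ((y - t) ^ 2 * gauss (y - t)) * scaledPrior π₀ τ t := by ring
        _ ≤ ((|y| + 2) ^ (-α) * (P * τ ^ (α - 1))) * scaledPrior π₀ τ t := by gcongr
        _ = polyLower α A τ y * (K * scaledPrior π₀ τ t) := by
            rw [hK, polyLower]
            field_simp
        _ ≤ _ := by
            gcongr
            exact le_add_of_nonneg_left (by positivity)
  refine (lintegral_mono hpt).trans (le_of_eq ?_)
  have hm1 : Measurable fun t : ℝ => ENNReal.ofReal (D * P)
      * ENNReal.ofReal (Real.exp (-b * (y - t) ^ 2)) := by fun_prop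
  have hsub : ∫⁻ t : ℝ, ENNReal.ofReal (Real.exp (-b * (y - t) ^ 2)) = G :=
    lintegral_sub_left_eq_self (fun x : ℝ => ENNReal.ofReal (Real.exp (-b * x ^ 2))) y
  rw [lintegral_const_mul' _ _ ENNReal.ofReal_ne_top, lintegral_add_left hm1,
    lintegral_const_mul' _ _ ENNReal.ofReal_ne_top, lintegral_const_mul' _ _ ENNReal.ofReal_ne_top,
    hsub, lintegral_scaledPrior hd hτ, mul_one, ENNReal.ofReal_mul hl.le,
    ENNReal.ofReal_add (by positivity) hK0.le,
    ENNReal.ofReal_mul (p := D * P) (q := G.toReal) (by positivity), ENNReal.ofReal_toReal hGfin]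

/-! ### Moments of the null coordinates. -/

theorem IsProbDensity.lintegral_abs_rpow_lt_top (hd : IsProbDensity π₀)
    (hb : TailBounds π₀ α M A B) {q : ℝ} (hα : 0 ≤ α) (hq0 : 0 ≤ q) (hq : q < α - 1) :
    ∫⁻ u, ENNReal.ofReal (|u| ^ q) * ENNReal.ofReal (π₀ u) < ∞ := by
  have hM := hb.M_pos
  have hB := hb.B_pos
  have hpt : ∀ u, ENNReal.ofReal (|u| ^ q) * ENNReal.ofReal (π₀ u)
      ≤ ENNReal.ofReal (M ^ q) * ENNReal.ofReal (π₀ u)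
        + ENNReal.ofReal (B * ((1 + M) / M) ^ α)
          * ENNReal.ofReal ((1 + ‖u‖) ^ (-(α - q))) := by
    intro u
    rcases le_or_gt |u| M with h | h
    · refine le_add_right ?_
      gcongr
    · refine le_add_left ?_
      rw [← ENNReal.ofReal_mul (by positivity), ← ENNReal.ofReal_mul (by positivity)]
      refine ENNReal.ofReal_le_ofReal ?_
      have hu : 0 < |u| := hM.trans h
      have h1 : |u| ^ (-α) ≤ ((1 + M) / M) ^ α * (1 + |u|) ^ (-α) := by
        rw [Real.rpow_neg hu.le, Real.rpow_neg (by positivity), ← div_eq_mul_inv,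
          ← Real.div_rpow (by positivity) (by positivity), ← Real.inv_rpow hu.le]
        refine Real.rpow_le_rpow (by positivity) ?_ hα
        rw [div_div, inv_eq_one_div, div_le_div_iff₀ hu (by positivity)]
        nlinarith
      have h2 : |u| ^ q ≤ (1 + |u|) ^ q := Real.rpow_le_rpow hu.le (by linarith) hq0
      calc |u| ^ q * π₀ u
          ≤ (1 + |u|) ^ q * (B * (((1 + M) / M) ^ α * (1 + |u|) ^ (-α))) :=
            mul_le_mul h2 ((hb.upper u h).trans (by gcongr)) (hd.nonneg u) (by positivity)
        _ = _ := by
            rw [Real.norm_eq_abs, show -(α - q) = q + -α by ring, Real.rpow_add (by positivity)]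
            ring
  refine (lintegral_mono hpt).trans_lt ?_
  have hint : Integrable fun u : ℝ => (1 + ‖u‖) ^ (-(α - q)) :=
    integrable_one_add_norm (by simp; linarith)
  rw [lintegral_add_left (hd.measurable.ennreal_ofReal.const_mul _),
    lintegral_const_mul' _ _ ENNReal.ofReal_ne_top, lintegral_const_mul' _ _ ENNReal.ofReal_ne_top,
    hd.lintegral_eq_one]
  have := hint.lintegral_lt_top
  finiteness

theorem lintegral_lintegral_mul_jointDensity (hd : IsProbDensity π₀) {f : ℝ → ℝ≥0∞}
    (hf : Measurable f) :
    ∫⁻ y, ∫⁻ t, f t * jointDensity π₀ τ y t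
      = ∫⁻ t, f t * ENNReal.ofReal (scaledPrior π₀ τ t) := by
  rw [lintegral_lintegral_swap]
  · refine lintegral_congr fun t => ?_
    have : ∀ y, f t * jointDensity π₀ τ y t
        = ENNReal.ofReal (gauss (y - t)) * (f t * ENNReal.ofReal (scaledPrior π₀ τ t)) := by
      intro y
      rw [jointDensity_eq, ENNReal.ofReal_mul (gauss_nonneg _), mul_left_comm]
    simp_rw [this]
    rw [lintegral_mul_const _ (by have := measurable_gauss; fun_prop), lintegral_gauss_sub, one_mul]
  · exact ((hf.comp measurable_snd).mul (measurable_jointDensity_uncurry hd)).aemeasurable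

/-- The expected posterior moments of a null coordinate. -/
theorem TailBounds.exists_null_moment_le (hb : TailBounds π₀ α M A B) (hd : IsProbDensity π₀)
    (hα : 0 ≤ α) {q : ℝ} (hq0 : 0 ≤ q) (hq : q < α - 1) :
    ∃ C : ℝ, 0 ≤ C ∧ ∀ (τ T : ℝ) (p : ℕ), 0 < τ → (M + 2) * τ ≤ 1 → 1 ≤ T → p ≤ 2 → q ≤ p →
      ∫⁻ y, postMean π₀ τ (fun t => ENNReal.ofReal (|t| ^ p)) y ∂(gaussianReal 0 1)
        ≤ ENNReal.ofReal (C * (τ ^ q * T ^ (p - q) + Real.exp (-(T ^ 2) / 8))) := by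
  have hA := hb.A_pos
  have hB := hb.B_pos
  have hM := hb.M_pos
  have hg2 := gauss_pos 2
  obtain ⟨P, hP, hPle⟩ := exists_rpow_le_exp_sq (α + 2) (η := 1 / 8) (by norm_num)
  obtain ⟨Q, hQ, hQle⟩ := exists_rpow_le_exp_sq 2 (η := 1 / 8) (by norm_num)
  set D := B / (gauss 2 * A) with hD
  have hD0 : 0 < D := by positivity
  set E := D * (P * Q) with hE
  have hE0 : 0 < E := by positivity
  set G := ∫⁻ x : ℝ, ENNReal.ofReal (Real.exp (-(1 / 8) * x ^ 2)) with hG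
  have hGfin : G ≠ ∞ := (lintegral_exp_neg_mul_sq_lt_top (by norm_num)).ne
  set I := ∫⁻ u, ENNReal.ofReal (|u| ^ q) * ENNReal.ofReal (π₀ u) with hI
  have hIfin : I ≠ ∞ := (hd.lintegral_abs_rpow_lt_top hb hα hq0 hq).ne
  set c₀ := Real.exp (-1 / 2) * (A * (M + 2) ^ (-α)) with hc₀
  have hc0 : 0 < c₀ := by positivity
  refine ⟨c₀⁻¹ * I.toReal + E * G.toReal * G.toReal, by positivity,
    fun τ T p hτ hMτ hT hp2 hqp => ?_⟩
  have hMτ' : M * τ < 1 := by nlinarith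
  -- Up to `T`, lower the exponent from `p` to `q`, whose prior moment is finite. Beyond `T`,
  -- compare with `polyLower`.
  have hpt : ∀ y t, ENNReal.ofReal (|t| ^ p) * jointDensity π₀ τ y t
      ≤ ENNReal.ofReal (T ^ (p - q)) * (ENNReal.ofReal (|t| ^ q) * jointDensity π₀ τ y t)
        + ENNReal.ofReal (polyLower α A τ y * (E * Real.exp (-(T ^ 2) / 8)
            * Real.exp (3 / 8 * y ^ 2))) * ENNReal.ofReal (Real.exp (-(1 / 8) * (y - t) ^ 2)) := by
    intro y t
    rcases le_or_gt |t| T with ht | ht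
    · refine le_add_right ?_
      rw [← mul_assoc, ← ENNReal.ofReal_mul (by positivity)]
      gcongr
      rcases eq_or_ne t 0 with rfl | h0
      · rcases Nat.eq_zero_or_pos p with rfl | hp
        · have : q = 0 := le_antisymm (by simpa using hqp) hq0
          simp [this]
        · rw [abs_zero, zero_pow hp.ne']
          positivity
      · have h0' : 0 < |t| := abs_pos.2 h0
        calc |t| ^ p = |t| ^ ((p : ℝ) - q) * |t| ^ q := by
              rw [← Real.rpow_add h0', sub_add_cancel, Real.rpow_natCast]
          _ ≤ T ^ ((p : ℝ) - q) * |t| ^ q := by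
              gcongr
    · refine le_add_left ?_
      have hl := polyLower_pos (α := α) hA hτ y
      rw [jointDensity_eq, ← ENNReal.ofReal_mul (by positivity),
        ← ENNReal.ofReal_mul (by positivity)]
      refine ENNReal.ofReal_le_ofReal ?_
      have h1t : 1 ≤ |t| := hT.trans ht.le
      set v := |y - t| with hv
      have hv0 : 0 ≤ v := abs_nonneg _
      have htri : |t| ≤ |y| + v := by
        have := abs_sub y (y - t)
        rwa [sub_sub_cancel] at this
      have hpow : |t| ^ p ≤ (3 + |y|) ^ (2 : ℝ) * (3 + v) ^ (2 : ℝ) := by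
        calc |t| ^ p ≤ |t| ^ 2 := pow_le_pow_right₀ h1t hp2
          _ ≤ ((3 + |y|) * (3 + v)) ^ 2 := by
              gcongr
              nlinarith [abs_nonneg y]
          _ = _ := by rw [mul_pow, Real.rpow_two, Real.rpow_two]
      -- If `|t| > T`, then `y² + v² ≥ T² / 2`. Half of the exponent `v² / 2` is spent on this; the
      -- resulting growth `exp(y²/4)`, with another `y²/8` from the polynomial, stays below the
      -- decay `exp(-y²/2)` of the data law.
      have hexp : gauss (y - t) ≤ Real.exp (-(T ^ 2) / 8) * Real.exp (1 / 4 * y ^ 2)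
          * Real.exp (-(1 / 4) * v ^ 2) := by
        refine (gauss_le_exp _).trans ?_
        rw [← Real.exp_add, ← Real.exp_add]
        refine Real.exp_le_exp.2 ?_
        have h1 : T ^ 2 ≤ (|y| + v) ^ 2 := by gcongr; exact ht.le.trans htri
        have h2 : (|y| + v) ^ 2 ≤ 2 * (y ^ 2 + v ^ 2) := by
          nlinarith [sq_nonneg (|y| - v), sq_abs y]
        rw [← sq_abs (y - t), ← hv]
        linarith
      have hv2 : (3 + v) ^ α * (3 + v) ^ (2 : ℝ) ≤ P * Real.exp (1 / 8 * v ^ 2) := by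
        rw [← Real.rpow_add (by positivity)]
        exact hPle v hv0
      have hy2 : (3 + |y|) ^ (2 : ℝ) ≤ Q * Real.exp (1 / 8 * y ^ 2) := by
        rw [← sq_abs y]
        exact hQle |y| (abs_nonneg y)
      calc |t| ^ p * (gauss (y - t) * scaledPrior π₀ τ t)
          ≤ ((3 + |y|) ^ (2 : ℝ) * (3 + v) ^ (2 : ℝ))
            * (polyLower α A τ y * (D * ((3 + v) ^ α * gauss (y - t)))) :=
            mul_le_mul hpow (hb.gauss_mul_scaledPrior_le hα hτ hMτ' y h1t)
              (mul_nonneg (gauss_nonneg _) (scaledPrior_nonneg hd hτ t)) (by positivity)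
        _ = polyLower α A τ y * (D * (((3 + v) ^ α * (3 + v) ^ (2 : ℝ)) * (3 + |y|) ^ (2 : ℝ)
              * gauss (y - t))) := by ring
        _ ≤ polyLower α A τ y * (D * ((P * Real.exp (1 / 8 * v ^ 2)) * (Q * Real.exp (1 / 8 * y ^ 2))
              * (Real.exp (-(T ^ 2) / 8) * Real.exp (1 / 4 * y ^ 2)
                * Real.exp (-(1 / 4) * v ^ 2)))) := by
            have := gauss_nonneg (y - t)
            gcongr
        _ = polyLower α A τ y * (E * Real.exp (-(T ^ 2) / 8)
              * (Real.exp (1 / 8 * y ^ 2) * Real.exp (1 / 4 * y ^ 2)))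
            * (Real.exp (1 / 8 * v ^ 2) * Real.exp (-(1 / 4) * v ^ 2)) := by
            rw [hE]; ring
        _ = _ := by
            rw [← Real.exp_add (1 / 8 * y ^ 2), ← Real.exp_add (1 / 8 * v ^ 2), hv, sq_abs]
            congr 4 <;> ring
  have hJ : ∀ y, ENNReal.ofReal (gauss (y - 0))
        * postMean π₀ τ (fun t => ENNReal.ofReal (|t| ^ p)) y
      ≤ ENNReal.ofReal (c₀⁻¹ * T ^ (p - q))
          * (∫⁻ t, ENNReal.ofReal (|t| ^ q) * jointDensity π₀ τ y t)
        + ENNReal.ofReal (E * Real.exp (-(T ^ 2) / 8)) * G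
          * ENNReal.ofReal (Real.exp (-(1 / 8) * y ^ 2)) := by
    intro y
    have hl := polyLower_pos (α := α) hA hτ y
    have hgy := gauss_pos y
    have hsub : ∫⁻ t : ℝ, ENNReal.ofReal (Real.exp (-(1 / 8) * (y - t) ^ 2)) = G :=
      lintegral_sub_left_eq_self (fun x : ℝ => ENNReal.ofReal (Real.exp (-(1 / 8) * x ^ 2))) y
    have hmeas : Measurable fun t : ℝ => ENNReal.ofReal (T ^ (p - q))
        * (ENNReal.ofReal (|t| ^ q) * jointDensity π₀ τ y t) := by
      have := measurable_jointDensity (τ := τ) hd y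
      have h2 : Measurable fun t : ℝ => ENNReal.ofReal (|t| ^ q) := by fun_prop
      exact (h2.mul this).const_mul _
    have hint : ∫⁻ t, ENNReal.ofReal (|t| ^ p) * jointDensity π₀ τ y t
        ≤ ENNReal.ofReal (T ^ (p - q)) * (∫⁻ t, ENNReal.ofReal (|t| ^ q) * jointDensity π₀ τ y t)
          + ENNReal.ofReal (polyLower α A τ y * (E * Real.exp (-(T ^ 2) / 8)
            * Real.exp (3 / 8 * y ^ 2) * G.toReal)) := by
      refine (lintegral_mono (hpt y)).trans (le_of_eq ?_)
      rw [lintegral_add_left hmeas, lintegral_const_mul' _ _ ENNReal.ofReal_ne_top,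
        lintegral_const_mul' _ _ ENNReal.ofReal_ne_top, hsub,
        ← mul_assoc (polyLower α A τ y) _ G.toReal,
        ENNReal.ofReal_mul (q := G.toReal) (by positivity),
        ENNReal.ofReal_toReal hGfin]
    have hfst : (marginal π₀ τ y)⁻¹ ≤ (ENNReal.ofReal (c₀ * gauss y))⁻¹ :=
      ENNReal.inv_le_inv.2 (hb.gauss_le_marginal hα hτ hMτ y)
    -- This replaces the data density divided by the marginal with a constant, so that `y` can then
    -- be integrated out of the joint density.
    have hginv : ENNReal.ofReal (gauss y) * (marginal π₀ τ y)⁻¹ ≤ ENNReal.ofReal c₀⁻¹ := by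
      refine (mul_le_mul_right hfst _).trans (le_of_eq ?_)
      rw [← ENNReal.ofReal_inv_of_pos (by positivity), ← ENNReal.ofReal_mul hgy.le]
      congr 1
      field_simp
    have hsnd := inv_marginal_mul_le hl (hb.polyLower_le_marginal hα hτ hMτ' y)
      (le_refl (ENNReal.ofReal (polyLower α A τ y * (E * Real.exp (-(T ^ 2) / 8)
            * Real.exp (3 / 8 * y ^ 2) * G.toReal))))
    rw [sub_zero, postMean]
    calc ENNReal.ofReal (gauss y) * ((marginal π₀ τ y)⁻¹
            * ∫⁻ t, ENNReal.ofReal (|t| ^ p) * jointDensity π₀ τ y t)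
        ≤ ENNReal.ofReal (gauss y) * ((marginal π₀ τ y)⁻¹ * (ENNReal.ofReal (T ^ (p - q))
            * (∫⁻ t, ENNReal.ofReal (|t| ^ q) * jointDensity π₀ τ y t)
          + ENNReal.ofReal (polyLower α A τ y * (E * Real.exp (-(T ^ 2) / 8)
            * Real.exp (3 / 8 * y ^ 2) * G.toReal)))) := by gcongr
      _ = (ENNReal.ofReal (gauss y) * (marginal π₀ τ y)⁻¹) * (ENNReal.ofReal (T ^ (p - q))
            * (∫⁻ t, ENNReal.ofReal (|t| ^ q) * jointDensity π₀ τ y t))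
          + ENNReal.ofReal (gauss y) * ((marginal π₀ τ y)⁻¹
            * ENNReal.ofReal (polyLower α A τ y * (E * Real.exp (-(T ^ 2) / 8)
            * Real.exp (3 / 8 * y ^ 2) * G.toReal))) := by
          rw [mul_add, mul_add, mul_assoc (ENNReal.ofReal (gauss y))]
      _ ≤ ENNReal.ofReal c₀⁻¹ * (ENNReal.ofReal (T ^ (p - q))
            * (∫⁻ t, ENNReal.ofReal (|t| ^ q) * jointDensity π₀ τ y t))
          + ENNReal.ofReal (Real.exp (-(y ^ 2) / 2))
            * ENNReal.ofReal (E * Real.exp (-(T ^ 2) / 8) * Real.exp (3 / 8 * y ^ 2)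
              * G.toReal) := by
          gcongr
          exact gauss_le_exp y
      _ = _ := by
          have e : Real.exp (-(y ^ 2) / 2)
              * (E * Real.exp (-(T ^ 2) / 8) * Real.exp (3 / 8 * y ^ 2) * G.toReal)
              = E * Real.exp (-(T ^ 2) / 8) * G.toReal * Real.exp (-(1 / 8) * y ^ 2) := by
            rw [show -(1 / 8) * y ^ 2 = -(y ^ 2) / 2 + 3 / 8 * y ^ 2 by ring, Real.exp_add]
            ring
          rw [← mul_assoc, ← ENNReal.ofReal_mul (by positivity),
            ← ENNReal.ofReal_mul (p := Real.exp (-(y ^ 2) / 2)) (by positivity), e,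
            ENNReal.ofReal_mul (q := Real.exp (-(1 / 8) * y ^ 2)) (by positivity),
            ENNReal.ofReal_mul (q := G.toReal) (by positivity), ENNReal.ofReal_toReal hGfin]
  have hmq : Measurable fun t : ℝ => ENNReal.ofReal (|t| ^ q) := by fun_prop
  have hIτ : ∫⁻ t, ENNReal.ofReal (|t| ^ q) * ENNReal.ofReal (scaledPrior π₀ τ t)
      = ENNReal.ofReal (τ ^ q * I.toReal) := by
    rw [lintegral_mul_scaledPrior hd hτ hmq, ENNReal.ofReal_mul (by positivity),
      ENNReal.ofReal_toReal hIfin, hI, ← lintegral_const_mul' _ _ ENNReal.ofReal_ne_top]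
    refine lintegral_congr fun u => ?_
    rw [abs_mul, abs_of_pos hτ, Real.mul_rpow hτ.le (abs_nonneg u),
      ENNReal.ofReal_mul (by positivity), mul_assoc]
  have hmp : Measurable fun t : ℝ => ENNReal.ofReal (|t| ^ p) := by fun_prop
  rw [lintegral_gaussianReal_eq 0 (measurable_postMean hd hmp)]
  refine (lintegral_mono hJ).trans ?_
  have hme : Measurable fun y : ℝ => ENNReal.ofReal (E * Real.exp (-(T ^ 2) / 8)) * G
      * ENNReal.ofReal (Real.exp (-(1 / 8) * y ^ 2)) := by fun_prop
  rw [lintegral_add_right _ hme, lintegral_const_mul' _ _ ENNReal.ofReal_ne_top,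
    lintegral_lintegral_mul_jointDensity hd hmq, hIτ,
    lintegral_const_mul' _ _ (ENNReal.mul_ne_top ENNReal.ofReal_ne_top hGfin), ← hG,
    ← ENNReal.ofReal_mul (by positivity)]
  have hGG : ENNReal.ofReal (E * Real.exp (-(T ^ 2) / 8)) * G * G
      = ENNReal.ofReal (E * Real.exp (-(T ^ 2) / 8) * G.toReal * G.toReal) := by
    rw [ENNReal.ofReal_mul (q := G.toReal) (by positivity),
      ENNReal.ofReal_mul (q := G.toReal) (by positivity), ENNReal.ofReal_toReal hGfin]
  rw [hGG, ← ENNReal.ofReal_add (by positivity) (by positivity)]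
  refine ENNReal.ofReal_le_ofReal ?_
  have h1 : 0 ≤ c₀⁻¹ * I.toReal * Real.exp (-(T ^ 2) / 8) := by positivity
  have h2 : 0 ≤ E * G.toReal * G.toReal * (τ ^ q * T ^ (p - q)) := by positivity
  nlinarith

/-! ### Excess loss around the true value. -/

/-- With `v = y - t` and `ε = y - μ`, this passes from distance to the observation to distance to
the truth. For `p = 2` it is Young's inequality `(ε - v)² ≤ (1 + η) v² + (1 + 1/η) ε²`; the noise
costs only a factor near one on `T`. -/
theorem abs_pow_sub_le {η T ε v : ℝ} (hη : 0 < η) (hη1 : η < 1) (hT : 1 ≤ T) {p : ℕ}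
    (hp : p = 1 ∨ p = 2) :
    |ε - v| ^ p - (√(1 + η) * T) ^ p
      ≤ 2 * (if T < |v| then v ^ 2 else 0) + (1 + 1 / η) * (1 + ε ^ 2) := by
  have hinv : 0 < 1 / η := by positivity
  rcases hp with rfl | rfl
  · have h1 : |ε - v| ≤ |ε| + |v| := abs_sub ε v
    have h2 : |ε| ≤ 1 + ε ^ 2 := by nlinarith [sq_nonneg (|ε| - 1), sq_abs ε]
    have h3 : 0 ≤ 1 / η * (1 + ε ^ 2) := by positivity
    have h4 : 1 ≤ √(1 + η) := Real.one_le_sqrt.2 (by linarith)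
    have h5 : T ≤ √(1 + η) * T := le_mul_of_one_le_left (by linarith) h4
    rw [pow_one, pow_one]
    split_ifs with h
    · nlinarith [sq_abs v]
    · linarith
  · have h1 : 0 ≤ (η * v + ε) ^ 2 / η := by positivity
    have e : (η * v + ε) ^ 2 / η = η * v ^ 2 + 2 * (v * ε) + 1 / η * ε ^ 2 := by
      field_simp
      ring
    rw [sq_abs, mul_pow, Real.sq_sqrt (by linarith)]
    split_ifs with h
    · nlinarith [sq_nonneg v, mul_nonneg hη.le (sq_nonneg T), sq_nonneg T]
    · have h2 : v ^ 2 ≤ T ^ 2 := by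
        rw [← sq_abs v]
        exact pow_le_pow_left₀ (abs_nonneg v) (not_lt.1 h) 2
      nlinarith

theorem lintegral_gauss_mul_one_add_sq_lt_top :
    ∫⁻ x, ENNReal.ofReal (gauss x) * ENNReal.ofReal (1 + x ^ 2) < ∞ := by
  have hpt : ∀ x, ENNReal.ofReal (gauss x) * ENNReal.ofReal (1 + x ^ 2)
      ≤ ENNReal.ofReal 4 * ENNReal.ofReal (Real.exp (-(1 / 4) * x ^ 2)) := by
    intro x
    rw [← ENNReal.ofReal_mul (gauss_nonneg x), ← ENNReal.ofReal_mul (by norm_num)]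
    refine ENNReal.ofReal_le_ofReal ?_
    have h1 : 1 + x ^ 2 ≤ 4 * Real.exp (x ^ 2 / 4) := by
      linarith [Real.add_one_le_exp (x ^ 2 / 4), sq_nonneg x]
    calc gauss x * (1 + x ^ 2) ≤ Real.exp (-(x ^ 2) / 2) * (4 * Real.exp (x ^ 2 / 4)) :=
          mul_le_mul (gauss_le_exp x) h1 (by positivity) (Real.exp_nonneg _)
      _ = _ := by
          rw [mul_left_comm, ← Real.exp_add]
          congr 2
          ring
  refine (lintegral_mono hpt).trans_lt ?_
  rw [lintegral_const_mul' _ _ ENNReal.ofReal_ne_top]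
  exact ENNReal.mul_lt_top ENNReal.ofReal_lt_top (lintegral_exp_neg_mul_sq_lt_top (by norm_num))

/-- The expected posterior excess loss of an arbitrary coordinate beyond a logarithmic radius. -/
theorem TailBounds.exists_excess_loss_le (hb : TailBounds π₀ α M A B) (hd : IsProbDensity π₀)
    (hα : 0 ≤ α) {η : ℝ} (hη : 0 < η) (hη1 : η < 1) :
    ∃ C : ℝ, 0 ≤ C ∧ ∀ (τ T : ℝ) (p : ℕ) (μ : ℝ), 0 < τ → M * τ < 1 → 1 ≤ T → p = 1 ∨ p = 2 →
      Real.exp (-((1 - η) / 2) * T ^ 2) ≤ τ ^ (α - 1) →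
      ∫⁻ y, postMean π₀ τ (fun t => ENNReal.ofReal (|t - μ| ^ p - (√(1 + η) * T) ^ p)) y
        ∂(gaussianReal μ 1) ≤ ENNReal.ofReal C := by
  obtain ⟨C, hC, hCle⟩ := hb.exists_postMean_excess_le hd hα hη hη1
  set J := ∫⁻ x, ENNReal.ofReal (gauss x) * ENNReal.ofReal (1 + x ^ 2) with hJ
  have hJfin : J ≠ ∞ := lintegral_gauss_mul_one_add_sq_lt_top.ne
  refine ⟨2 * C + (1 + 1 / η) * J.toReal, by positivity, fun τ T p μ hτ hMτ hT hp hexp => ?_⟩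
  have hpm : ∀ y, postMean π₀ τ
        (fun t => ENNReal.ofReal (|t - μ| ^ p - (√(1 + η) * T) ^ p)) y
      ≤ ENNReal.ofReal (2 * C) + ENNReal.ofReal (1 + 1 / η) * ENNReal.ofReal (1 + (y - μ) ^ 2) := by
    intro y
    have hk := measurable_jointDensity (τ := τ) hd y
    have hpt : ∀ t, ENNReal.ofReal (|t - μ| ^ p - (√(1 + η) * T) ^ p) * jointDensity π₀ τ y t
        ≤ ENNReal.ofReal 2 * (ENNReal.ofReal (if T < |y - t| then (y - t) ^ 2 else 0)
            * jointDensity π₀ τ y t)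
          + ENNReal.ofReal (1 + 1 / η) * ENNReal.ofReal (1 + (y - μ) ^ 2)
            * jointDensity π₀ τ y t := by
      intro t
      rw [← mul_assoc, ← add_mul, ← ENNReal.ofReal_mul (by norm_num),
        ← ENNReal.ofReal_mul (by positivity),
        ← ENNReal.ofReal_add (by split_ifs <;> positivity) (by positivity)]
      gcongr
      have := abs_pow_sub_le (ε := y - μ) (v := y - t) hη hη1 hT hp
      rwa [sub_sub_sub_cancel_left] at this
    have hint := lintegral_mono (μ := volume) hpt
    rw [lintegral_add_right _ (hk.const_mul _), lintegral_const_mul' _ _ ENNReal.ofReal_ne_top,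
      lintegral_const_mul _ hk] at hint
    change _ ≤ _ + _ * marginal π₀ τ y at hint
    rw [postMean]
    refine (mul_le_mul_right hint _).trans ?_
    rw [mul_add, mul_left_comm, mul_left_comm (marginal π₀ τ y)⁻¹ _ (marginal π₀ τ y),
      ENNReal.inv_mul_cancel (hb.marginal_ne_zero hα hτ hMτ y) (marginal_ne_top hd hτ y), mul_one,
      ENNReal.ofReal_mul (by norm_num)]
    gcongr
    exact hCle τ T hτ hMτ (by linarith) hexp y
  refine (lintegral_mono hpm).trans (le_of_eq ?_)
  have hm : Measurable fun y : ℝ => ENNReal.ofReal (1 + (y - μ) ^ 2) := by fun_prop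
  rw [lintegral_add_left measurable_const, lintegral_const, measure_univ, mul_one,
    lintegral_const_mul' _ _ ENNReal.ofReal_ne_top, lintegral_gaussianReal_eq μ hm,
    lintegral_sub_right_eq_self
      (fun x : ℝ => ENNReal.ofReal (gauss x) * ENNReal.ofReal (1 + x ^ 2)) μ, ← hJ,
    ENNReal.ofReal_add (p := 2 * C) (by positivity) (by positivity),
    ENNReal.ofReal_mul (q := J.toReal) (by positivity), ENNReal.ofReal_toReal hJfin]

/-! ### Assembly over coordinates and choice of rates. -/

/-- Coordinatewise loss bounds control the expected posterior probability of a large total loss. -/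
theorem expectedPosterior_le_of_coordinate_bounds (hd : IsProbDensity π₀) (hτ : 0 < τ)
    (hpos : ∀ y, marginal π₀ τ y ≠ 0) {n : ℕ} (θ' : Fin n → ℝ) {p : ℕ} {r N Z K : ℝ}
    (hN0 : 0 ≤ N) (hZ0 : 0 ≤ Z) (hK : 0 < K)
    (hN : ∀ μ, ∫⁻ y, postMean π₀ τ (fun t => ENNReal.ofReal (|t - μ| ^ p - r)) y
      ∂(gaussianReal μ 1) ≤ ENNReal.ofReal N)
    (hZ : ∫⁻ y, postMean π₀ τ (fun t => ENNReal.ofReal (|t| ^ p)) y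
      ∂(gaussianReal 0 1) ≤ ENNReal.ofReal Z) {S : Set (Fin n → ℝ)}
    (hS : S ⊆ {t | ({i : Fin n | θ' i ≠ 0}.ncard : ℝ) * r + K ≤ ∑ i, |t i - θ' i| ^ p}) :
    expectedPosterior π₀ τ θ' S
      ≤ ENNReal.ofReal (({i : Fin n | θ' i ≠ 0}.ncard * N + n * Z) / K) := by
  classical
  have hcard : ∀ x : ℝ, ∑ i, (if θ' i ≠ 0 then x else 0)
      = ({i : Fin n | θ' i ≠ 0}.ncard : ℝ) * x := by
    intro x
    rw [← Finset.sum_filter, Finset.sum_const, nsmul_eq_mul, Set.ncard_eq_toFinset_card',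
      Set.toFinset_ofPred]
  -- `ENNReal.ofReal` takes the positive part; the allowance `r` is subtracted on signal coordinates
  -- only.
  set g : Fin n → ℝ → ℝ≥0∞ :=
    fun i t => ENNReal.ofReal (|t - θ' i| ^ p - if θ' i ≠ 0 then r else 0) with hg
  have hgm : ∀ i, Measurable (g i) := fun i => by
    simp only [hg]
    fun_prop
  have hsub : S ⊆ {t | ENNReal.ofReal K ≤ ∑ i, g i (t i)} := by
    intro t ht
    have h1 : K ≤ ∑ i, max (|t i - θ' i| ^ p - if θ' i ≠ 0 then r else 0) 0 := by
      have h2 : K ≤ ∑ i, (|t i - θ' i| ^ p - if θ' i ≠ 0 then r else 0) := by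
        rw [Finset.sum_sub_distrib, hcard]
        have h3 := hS ht
        rw [Set.mem_ofPred_eq] at h3
        linarith
      exact h2.trans (Finset.sum_le_sum fun i _ => le_max_left _ _)
    refine (ENNReal.ofReal_le_ofReal h1).trans (le_of_eq ?_)
    rw [ENNReal.ofReal_sum_of_nonneg fun i _ => le_max_right _ _]
    refine Finset.sum_congr rfl fun i _ => ?_
    rw [ENNReal.ofReal_max, ENNReal.ofReal_zero, max_eq_left zero_le]
  refine (expectedPosterior_le hd hτ hpos (marginal_ne_top hd hτ) θ' g hgm
    (ENNReal.ofReal_pos.2 hK).ne' ENNReal.ofReal_ne_top hsub).trans ?_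
  have hi : ∀ i, ∫⁻ y, postMean π₀ τ (g i) y ∂(gaussianReal (θ' i) 1)
      ≤ ENNReal.ofReal ((if θ' i ≠ 0 then N else 0) + Z) := by
    intro i
    by_cases h : θ' i = 0
    · simp only [hg, h, ne_eq, not_true_eq_false, if_false, sub_zero, zero_add]
      exact hZ
    · simp only [hg, ne_eq, h, not_false_eq_true, if_true]
      exact (hN (θ' i)).trans (ENNReal.ofReal_le_ofReal (by linarith))
  calc (ENNReal.ofReal K)⁻¹ * ∑ i, ∫⁻ y, postMean π₀ τ (g i) y ∂(gaussianReal (θ' i) 1)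
      ≤ (ENNReal.ofReal K)⁻¹ * ∑ i, ENNReal.ofReal ((if θ' i ≠ 0 then N else 0) + Z) := by
        gcongr with i
        exact hi i
    _ = _ := by
        rw [← ENNReal.ofReal_sum_of_nonneg fun i _ => by split_ifs <;> positivity,
          Finset.sum_add_distrib, hcard, Finset.sum_const, Finset.card_univ, Fintype.card_fin,
          nsmul_eq_mul, mul_comm, ← div_eq_mul_inv, ENNReal.ofReal_div_of_pos hK]

/-- The net power of `x` is `1 - α * r < 0`, which beats any power of the logarithm. It is used with
`x = n / s` and `r = q / (α - 1)`. -/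
theorem tendsto_mul_rpow_neg_mul_log_rpow {α β r : ℝ} (hr : 1 < α * r) :
    Tendsto (fun x : ℝ => x * ((x⁻¹) ^ α * Real.log x ^ β) ^ r) atTop (𝓝 0) := by
  have h := (isLittleO_log_rpow_rpow_atTop (β * r) (sub_pos.2 hr)).tendsto_div_nhds_zero
  refine h.congr' ?_
  filter_upwards [eventually_gt_atTop 1] with x hx
  have hx0 : 0 < x := by linarith
  have hl : 0 < Real.log x := Real.log_pos hx
  rw [Real.mul_rpow (by positivity) (by positivity), ← Real.rpow_mul (by positivity),
    ← Real.rpow_mul hl.le, Real.inv_rpow hx0.le, Real.rpow_sub hx0, Real.rpow_one]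
  have := (Real.rpow_pos_of_pos hx0 (α * r)).ne'
  field_simp

/-- The global scale is negligible with respect to the sparsity level. -/
theorem tendsto_ratio_mul_rpow {α q : ℝ} {s : ℕ → ℕ} {τ : ℕ → ℝ} (hα : 1 < α) (hq0 : 0 < q)
    (hq : (α - 1) / α < q) (hτ : ∀ n, 0 < τ n)
    (hx : Tendsto (fun n : ℕ => (n : ℝ) / s n) atTop atTop)
    (hτ_upper : StrictlySmallerOrder
      (fun n : ℕ => (τ n) ^ (α - 1))
      (fun n : ℕ => ((s n : ℝ) / n) ^ α * (Real.log ((n : ℝ) / s n)) ^ ((α + 1) / 2))) :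
    Tendsto (fun n : ℕ => (n : ℝ) / s n * τ n ^ q) atTop (𝓝 0) := by
  have hα1 : 0 < α - 1 := by linarith
  have hr : 1 < α * (q / (α - 1)) := by
    rw [← mul_div_assoc, one_lt_div hα1]
    rw [div_lt_iff₀ (by linarith)] at hq
    linarith
  refine squeeze_zero' ?_ ?_ ((tendsto_mul_rpow_neg_mul_log_rpow (β := (α + 1) / 2) hr).comp hx)
  · exact Eventually.of_forall fun n => by have := hτ n; positivity
  · filter_upwards [hτ_upper.eventually_ge_atTop 1] with n hn
    have hτn := hτ n
    have ha : 0 < τ n ^ (α - 1) := by positivity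
    rw [le_div_iff₀ ha, one_mul] at hn
    rw [Function.comp_apply, inv_div]
    have : τ n ^ q = (τ n ^ (α - 1)) ^ (q / (α - 1)) := by
      rw [← Real.rpow_mul hτn.le, mul_div_cancel₀ _ hα1.ne']
    rw [this]
    gcongr

/-- The posterior `ℓ^p` loss exceeds `κ s (log n)^(p/2)` with vanishing expected probability. -/
theorem tendsto_expectedPosterior_pow_loss {π₀ : ℝ → ℝ} {α ω c : ℝ}
    (hdens : IsProbDensity π₀) (hα : 1 < α) (htail : HasPolynomialTail π₀ α)
    (hc : c ∈ Set.Ioo 0 (1 + ω / 2)) {θstar : (n : ℕ) → Fin n → ℝ} {s : ℕ → ℕ}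
    (hs : ∀ n, {i : Fin n | θstar n i ≠ 0}.ncard = s n)
    (hs_pos : ∀ᶠ n in atTop, 1 ≤ s n)
    (hs_sparse : (fun n : ℕ => (s n : ℝ)) =o[atTop] (fun n : ℕ => (n : ℝ)))
    {τ : ℕ → ℝ} (hτ : ∀ n, 0 < τ n)
    (hτ_lower : ∀ᶠ n : ℕ in atTop,
      (1 / (n : ℝ)) ^ c * (Real.log ((n : ℝ) / s n)) ^ (1 / 2 : ℝ) ≤ (τ n) ^ (α - 1))
    (hτ_upper : StrictlySmallerOrder
      (fun n : ℕ => (τ n) ^ (α - 1))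
      (fun n : ℕ => ((s n : ℝ) / n) ^ α * (Real.log ((n : ℝ) / s n)) ^ ((α + 1) / 2)))
    {p : ℕ} (hp : p = 1 ∨ p = 2) {κ : ℝ} (hκ : √(2 + ω) ^ p ≤ κ)
    {S : (n : ℕ) → Set (Fin n → ℝ)}
    (hS : ∀ n, S n ⊆ {t | κ * (s n * √(Real.log n) ^ p) ≤ ∑ i, |t i - θstar n i| ^ p}) :
    Tendsto (fun n => expectedPosterior π₀ (τ n) (θstar n) (S n)) atTop (𝓝 0) := by
  obtain ⟨M, A, B, hM, hA, hAB, hMAB⟩ := htail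
  have hb : TailBounds π₀ α M A B :=
    ⟨hM, hA, hAB, fun t ht => (hMAB t ht).1, fun t ht => (hMAB t ht).2⟩
  obtain ⟨hc0, hc1⟩ := hc
  have hα0 : 0 ≤ α := by linarith
  -- The interval is nonempty because `α > 1`. The lower end makes `(n / s) τ^q` vanish, `α - 1`
  -- keeps the prior moment finite, and `1` ensures `q ≤ p`.
  obtain ⟨q, hq1, hq2⟩ : ∃ q, (α - 1) / α < q ∧ q < min (α - 1) 1 :=
    exists_between (lt_min (div_lt_self (by linarith) hα) ((div_lt_one (by linarith)).2 (by linarith)))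
  obtain ⟨hqα, hq1'⟩ := lt_min_iff.1 hq2
  have hq0 : 0 < q := (div_pos (by linarith) (by linarith)).trans hq1
  have hp1 : 1 ≤ p := by omega
  have hp2 : p ≤ 2 := by omega
  have hqp : q ≤ p := hq1'.le.trans (by exact_mod_cast hp1)
  obtain ⟨η, hη, hη1, hηρ⟩ : ∃ η : ℝ, 0 < η ∧ η < 1 ∧ (1 + η) * (2 * c / (1 - η)) < 2 + ω := by
    have hden : 0 < 2 * (2 * c + 2 + ω) := by linarith
    have hη1 : (2 + ω - 2 * c) / (2 * (2 * c + 2 + ω)) < 1 := (div_lt_one hden).2 (by linarith)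
    -- Half of the value of `η` at which the required inequality becomes an equality.
    refine ⟨(2 + ω - 2 * c) / (2 * (2 * c + 2 + ω)), div_pos (by linarith) hden, hη1, ?_⟩
    set η := (2 + ω - 2 * c) / (2 * (2 * c + 2 + ω)) with hη
    rw [← mul_div_assoc, div_lt_iff₀ (by linarith)]
    have : η * (2 * (2 * c + 2 + ω)) = 2 + ω - 2 * c := div_mul_cancel₀ _ hden.ne'
    nlinarith
  set ρ := √(2 * c / (1 - η)) with hρ
  have hρ0 : 0 < ρ := Real.sqrt_pos.2 (div_pos (by linarith) (by linarith))
  have hρ2 : ρ ^ 2 = 2 * c / (1 - η) := Real.sq_sqrt (div_pos (by linarith) (by linarith)).le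
  set δ := κ - (√(1 + η) * ρ) ^ p with hδ
  have hδ0 : 0 < δ := by
    have h1 : √(1 + η) * ρ < √(2 + ω) := by
      rw [hρ, ← Real.sqrt_mul (by linarith)]
      exact Real.sqrt_lt_sqrt (mul_nonneg (by linarith) (div_nonneg (by linarith) (by linarith))) hηρ
    have h2 : (√(1 + η) * ρ) ^ p < √(2 + ω) ^ p :=
      pow_lt_pow_left₀ h1 (by positivity) (by omega)
    linarith
  obtain ⟨N, hN0, hN⟩ := hb.exists_excess_loss_le hdens hα0 hη hη1
  obtain ⟨C, hC0, hC⟩ := hb.exists_null_moment_le hdens hα0 hq0.le hqα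
  have hx : Tendsto (fun n : ℕ => (n : ℝ) / s n) atTop atTop := by
    have h1 := hs_sparse.tendsto_div_nhds_zero
    have h2 : Tendsto (fun n : ℕ => (s n : ℝ) / n) atTop (𝓝[>] 0) := by
      refine tendsto_nhdsWithin_iff.2 ⟨h1, ?_⟩
      filter_upwards [hs_pos, eventually_gt_atTop 0] with n h3 h4
      exact div_pos (Nat.cast_pos.2 h3 : (0 : ℝ) < s n) (Nat.cast_pos.2 h4 : (0 : ℝ) < n)
    refine h2.inv_tendsto_nhdsGT_zero.congr fun n => ?_
    rw [Pi.inv_apply, inv_div]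
  have hxτ := tendsto_ratio_mul_rpow hα hq0 hq1 hτ hx hτ_upper
  have hτ0 : Tendsto τ atTop (𝓝 0) := by
    have h1 : Tendsto (fun n => τ n ^ q) atTop (𝓝 0) := by
      refine squeeze_zero' (Eventually.of_forall fun n => (Real.rpow_pos_of_pos (hτ n) q).le) ?_ hxτ
      filter_upwards [hx.eventually_ge_atTop 1] with n hn
      exact le_mul_of_one_le_left (Real.rpow_pos_of_pos (hτ n) q).le hn
    have h2 := h1.rpow_const (p := q⁻¹) (Or.inr (by positivity))
    rw [Real.zero_rpow (by positivity)] at h2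
    refine h2.congr fun n => ?_
    rw [← Real.rpow_mul (hτ n).le, mul_inv_cancel₀ hq0.ne', Real.rpow_one]
  have hn : Tendsto (fun n : ℕ => (n : ℝ)) atTop atTop := tendsto_natCast_atTop_atTop
  have hℓ : Tendsto (fun n : ℕ => √(Real.log n)) atTop atTop :=
    Real.tendsto_sqrt_atTop.comp (Real.tendsto_log_atTop.comp hn)
  have hlim : Tendsto (fun n : ℕ => ENNReal.ofReal (N / δ * (√(Real.log n))⁻¹
      + 16 * C / δ * ((n : ℝ) / s n * τ n ^ q) + C / δ * (n : ℝ)⁻¹)) atTop (𝓝 0) := by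
    have := ((hℓ.inv_tendsto_atTop.const_mul (N / δ)).add (hxτ.const_mul (16 * C / δ))).add
      (hn.inv_tendsto_atTop.const_mul (C / δ))
    simp only [mul_zero, add_zero] at this
    rw [← ENNReal.ofReal_zero]
    exact ENNReal.tendsto_ofReal this
  refine tendsto_of_tendsto_of_tendsto_of_le_of_le' tendsto_const_nhds hlim
    (Eventually.of_forall fun _ => zero_le) ?_
  filter_upwards [hs_pos, eventually_gt_atTop 0, hτ_lower, hℓ.eventually_ge_atTop 1,
    hℓ.eventually_ge_atTop ρ⁻¹, (Real.tendsto_log_atTop.comp hx).eventually_ge_atTop 1,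
    hτ0.eventually_lt_const (show (0 : ℝ) < (M + 2)⁻¹ by positivity)]
    with n hsn hn0 hlow hℓ1 hℓρ hlogx hτn
  have hτp := hτ n
  set ℓ := √(Real.log n) with hℓdef
  have hℓ0 : 0 < ℓ := by linarith
  have hℓ2 : ℓ ^ 2 = Real.log n := Real.sq_sqrt (Real.log_natCast_nonneg n)
  have hn0' : (0 : ℝ) < n := by exact_mod_cast hn0
  have hs1 : (1 : ℝ) ≤ s n := by exact_mod_cast hsn
  have hMτ : (M + 2) * τ n ≤ 1 := by
    rw [lt_inv_comm₀ hτp (by positivity)] at hτn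
    rw [← le_div_iff₀ hτp, one_div]
    exact hτn.le
  have hMτ' : M * τ n < 1 := by nlinarith
  have hT1 : 1 ≤ ρ * ℓ := by
    rwa [inv_le_iff_one_le_mul₀' hρ0] at hℓρ
  have hexp : Real.exp (-((1 - η) / 2) * (ρ * ℓ) ^ 2) ≤ τ n ^ (α - 1) := by
    have h1 : Real.exp (-((1 - η) / 2) * (ρ * ℓ) ^ 2) = (1 / (n : ℝ)) ^ c := by
      rw [Real.rpow_def_of_pos (by positivity), one_div, Real.log_inv, mul_pow, hρ2, hℓ2]
      have : 1 - η ≠ 0 := by linarith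
      congr 1
      field_simp
    rw [h1]
    -- The logarithmic factor in the lower bound on `τ` is eventually at least one and can be
    -- dropped.
    refine le_trans (le_mul_of_one_le_right (by positivity) ?_) hlow
    exact Real.one_le_rpow hlogx (by norm_num)
  have hexp2 : Real.exp (-((4 * ℓ) ^ 2) / 8) = ((n : ℝ) ^ 2)⁻¹ := by
    rw [show -((4 * ℓ) ^ 2) / 8 = -(2 * Real.log n) by rw [mul_pow, hℓ2]; ring, Real.exp_neg,
      two_mul, Real.exp_add, Real.exp_log hn0', sq]
  -- The radius `4 * ℓ` makes the Gaussian remainder `n⁻²`, negligible after summing over `n`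
  -- coordinates.
  have hZ := hC (τ n) (4 * ℓ) p hτp hMτ (by linarith) hp2 hqp
  rw [hexp2] at hZ
  have hmain := expectedPosterior_le_of_coordinate_bounds hdens hτp
    (hb.marginal_ne_zero hα0 hτp hMτ') (θstar n) (K := δ * (s n * ℓ ^ p)) hN0 (by positivity)
    (by positivity) (fun μ => hN (τ n) (ρ * ℓ) p μ hτp hMτ' hT1 hp hexp) hZ (S := S n) (by
      refine (hS n).trans fun t ht => ?_
      rw [Set.mem_ofPred_eq] at ht ⊢
      refine le_trans (le_of_eq ?_) ht
      rw [hs n, hδ, ← mul_assoc √(1 + η), mul_pow _ ℓ]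
      ring)
  refine hmain.trans (ENNReal.ofReal_le_ofReal ?_)
  rw [hs n, div_le_iff₀ (by positivity)]
  have hℓp : ℓ ≤ ℓ ^ p := le_self_pow₀ hℓ1 (by omega)
  have hpow : (4 * ℓ) ^ ((p : ℝ) - q) ≤ 16 * ℓ ^ p := by
    calc (4 * ℓ) ^ ((p : ℝ) - q) ≤ (4 * ℓ) ^ (p : ℝ) :=
          Real.rpow_le_rpow_of_exponent_le (by linarith) (by linarith)
      _ = 4 ^ p * ℓ ^ p := by rw [Real.rpow_natCast, mul_pow]
      _ ≤ 4 ^ 2 * ℓ ^ p := by gcongr; norm_num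
      _ = _ := by norm_num
  have e : (N / δ * ℓ⁻¹ + 16 * C / δ * ((n : ℝ) / s n * τ n ^ q) + C / δ * (n : ℝ)⁻¹)
        * (δ * (s n * ℓ ^ p))
      = s n * (N * (ℓ ^ p / ℓ)) + (n * (C * (τ n ^ q * (16 * ℓ ^ p)))
        + n * (C * (((n : ℝ) ^ 2)⁻¹ * (s n * ℓ ^ p)))) := by
    field_simp
    ring
  rw [e, mul_add C, mul_add (n : ℝ)]
  have h1 : 1 ≤ ℓ ^ p / ℓ := (one_le_div hℓ0).2 hℓp
  have h2 : 1 ≤ s n * ℓ ^ p := one_le_mul_of_one_le_of_one_le hs1 (hℓ1.trans hℓp)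
  have hτq := (Real.rpow_pos_of_pos hτp q).le
  gcongr
  · exact le_mul_of_one_le_right hN0 h1
  · exact le_mul_of_one_le_right (by positivity) h2

end NormalMeans

theorem theorem2 (π₀ : ℝ → ℝ) (α ω c : ℝ)
    (hdens : NormalMeans.IsProbDensity π₀)
    (hdecr : StrictAntiOn π₀ (Set.Ioi 0))
    (hincr : MonotoneOn π₀ (Set.Iio 0))
    (hα : 1 < α)
    (htail : NormalMeans.HasPolynomialTail π₀ α)
    (hω : 0 < ω)
    (hc : c ∈ Set.Ioo 0 (1 + ω / 2))
    (θstar : (n : ℕ) → Fin n → ℝ)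
    (s : ℕ → ℕ)
    (hs : ∀ n, {i : Fin n | θstar n i ≠ 0}.ncard = s n)
    (hs_pos : ∀ᶠ n in atTop, 1 ≤ s n)
    (hs_sparse : (fun n : ℕ => (s n : ℝ)) =o[atTop] (fun n : ℕ => (n : ℝ)))
    (τ : ℕ → ℝ)
    (hτ : ∀ n, 0 < τ n)
    (hτ_lower : ∀ᶠ n : ℕ in atTop,
      (1 / (n : ℝ)) ^ c * (Real.log ((n : ℝ) / s n)) ^ (1 / 2 : ℝ) ≤ (τ n) ^ (α - 1))
    (hτ_upper : NormalMeans.StrictlySmallerOrder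
      (fun n : ℕ => (τ n) ^ (α - 1))
      (fun n : ℕ => ((s n : ℝ) / n) ^ α * (Real.log ((n : ℝ) / s n)) ^ ((α + 1) / 2))) :
    Tendsto (fun n : ℕ => NormalMeans.expectedPosterior π₀ (τ n) (θstar n)
      {θ | NormalMeans.normL2 (θ - θstar n) ≥
        NormalMeans.constL2 ω * (s n * Real.log n) ^ (1 / 2 : ℝ)}) atTop (𝓝 0) ∧
    Tendsto (fun n : ℕ => NormalMeans.expectedPosterior π₀ (τ n) (θstar n)
      {θ | NormalMeans.normL1 (θ - θstar n) ≥
        s n * NormalMeans.constL1 ω * (Real.log n) ^ (1 / 2 : ℝ)}) atTop (𝓝 0) := by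
  constructor
  · refine NormalMeans.tendsto_expectedPosterior_pow_loss hdens hα htail hc hs hs_pos hs_sparse hτ
      hτ_lower hτ_upper (p := 2) (Or.inr rfl) (κ := NormalMeans.constL2 ω ^ 2) ?_ fun n θ hθ => ?_
    -- Only the summand `√(2 + ω)` of the constant is needed; the rest is slack.
    · exact pow_le_pow_left₀ (Real.sqrt_nonneg _) (le_add_of_nonneg_right (Real.sqrt_nonneg _)) 2
    · have hlog := Real.log_natCast_nonneg n
      have hC : 0 ≤ NormalMeans.constL2 ω := add_nonneg (Real.sqrt_nonneg _) (Real.sqrt_nonneg _)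
      have h := pow_le_pow_left₀ (by positivity) (Set.mem_ofPred_eq ▸ hθ : _ ≥ _) 2
      rw [mul_pow, ← Real.sqrt_eq_rpow, Real.sq_sqrt (by positivity), NormalMeans.normL2,
        EuclideanSpace.norm_sq_eq] at h
      rw [Set.mem_ofPred_eq, Real.sq_sqrt hlog]
      simpa using h
  · refine NormalMeans.tendsto_expectedPosterior_pow_loss hdens hα htail hc hs hs_pos hs_sparse hτ
      hτ_lower hτ_upper (p := 1) (Or.inl rfl) (κ := NormalMeans.constL1 ω) ?_ fun n θ hθ => ?_
    · rw [pow_one, NormalMeans.constL1, add_assoc]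
      exact le_add_of_nonneg_right (by positivity)
    · have h := ge_iff_le.1 (Set.mem_ofPred_eq ▸ hθ : _ ≥ _)
      rw [← Real.sqrt_eq_rpow, NormalMeans.normL1, mul_assoc, mul_left_comm] at h
      simpa using h
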